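/- Let $\Lambda=\mathrm{diag}(\lambda_1,\dots,\lambda_{p+m})$ with $\lambda_i\in C^{0,1}([0,1])$ and $\lambda_1\le\dots\le\lambda_p<0<\lambda_{p+1}\le\dots\le\lambda_{p+m}$ on $[0,1]$, $M\in L^\infty(0,1)^{(p+m)\times(p+m)}$ and $Q\in\mathbb R^{p\times m}$. Write $y=(y_+,y_-)\in\mathbb R^p\times\mathbb R^m$ and consider the controlled system $$\partial_t y=\Lambda(x)\,\partial_x y+M(x)y,\qquad y_+(t,0)=Q\,y_-(t,0),\quad y_-(t,1)=u(t),\quad y(0,\cdot)=y^0,\qquad t>0,\ x\in(0,1).$$ For $y^0\in L^2(0,1)^{p+m}$ and $u\in L^2(0,+\infty)^m$, a (weak) solution is a function $y\in C^0([0,+\infty);L^2(0,1)^{p+m})$ such that for every $T>0$ $$\int_0^1 y(T,x)\cdot\varphi(T,x)\,dx-\int_0^1 y^0(x)\cdot\varphi(0,x)\,dx=\int_0^T\!\!\int_0^1 y\cdot\bigl(\partial_t\varphi-\Lambda\,\partial_x\varphi+(-\Lambda'+M^*)\varphi\bigr)\,dx\,dt+\int_0^T u(t)\cdot\Lambda_-(1)\varphi_-(t,1)\,dt$$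 for all $\varphi\in C^1([0,T]\times[0,1])^{p+m}$ with $\varphi_+(\cdot,1)=0$ and $\varphi_-(\cdot,0)=R^*\varphi_+(\cdot,0)$, where $R=-\Lambda_+(0)Q\Lambda_-(0)^{-1}$, $\Lambda_+=\mathrm{diag}(\lambda_1,\dots,\lambda_p)$, $\Lambda_-=\mathrm{diag}(\lambda_{p+1},\dots,\lambda_{p+m})$. The system is exactly controllable in time $T>0$ if for all $y^0,y^1\in L^2(0,1)^{p+m}$ there is $u\in L^2(0,+\infty)^m$ whose corresponding solution satisfies $y(T)=y^1$. The minimal time is the infimum in $[0,+\infty]$ of the $T>0$ in which the system is exactly controllable. Put $T_i=-\int_0^1\lambda_i^{-1}$ for $i\le p$ and $T_i=\int_0^1\lambda_i^{-1}$ for $i>p$. **Proposition.** Let $\lambda_2\in C^{0,1}([0,1])$ and $a\in L^\infty(0,1)$ satisfy $$-1\le\lambda_2<0\ \text{ on }[0,1],\qquad \lambda_2=-1\ \text{ on }[0,\tfrac12],\qquad -\int_{1/2}^1\frac{d\xi}{\lambda_2(\xi)}=\frac32,$$ $$a=0\ \text{ a.e. in }(\tfrac12,1),\qquad \int_0^{1/2}a(x)\,dx=\frac\pi2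 .$$ Consider the $4\times4$ system with $p=m=2$ $$\partial_t y_1=-\partial_x y_1+a(x)y_2,\quad \partial_t y_2=\lambda_2(x)\partial_x y_2-a(x)y_1,\quad \partial_t y_3=\tfrac12\partial_x y_3,\quad \partial_t y_4=\partial_x y_4,$$ $$y_1(t,0)=y_3(t,0),\quad y_2(t,0)=y_4(t,0),\quad y_3(t,1)=u_1(t),\quad y_4(t,1)=u_2(t),$$ that is, $\Lambda=\mathrm{diag}(-1,\lambda_2,\tfrac12,1)$ and $Q=\mathrm{Id}$. Then: 1. The speeds satisfy $\lambda_1\le\lambda_2<0<\lambda_3\le\lambda_4$ on $[0,1]$, but it is not true that any two speeds that agree at some point of $[0,1]$ agree on all of $[0,1]$. 2. $T_1=1$, $T_2=2$, $T_3=2$, $T_4=1$; in particular $T_p+T_{p+1}=T_2+T_3=4$. 3. For $T>0$, the system is exactly controllable in time $T$ if and only if $T\ge 4$; in particular its minimal time is $4=T_p+T_{p+1}$. 4. For $T>0$, the same system with $a$ replaced by $0$ is exactly controllable in time $T$ if and only if $T\ge3$; in particular its minimal time is $3$. -/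

import Mathlib

open MeasureTheory Set
open scoped ENNReal NNReal

namespace HyperbolicControl

/-- `L²(0,1)`. -/
abbrev L2Space : Type := Lp ℝ 2 (volume.restrict (Ioo (0 : ℝ) 1))

/-- `L²(0,+∞)`. -/
abbrev L2Time : Type := Lp ℝ 2 (volume.restrict (Ioi (0 : ℝ)))

/-- The `n = p + m` equations are indexed by `Fin p ⊕ Fin m`: the index `inl i` stands for the
components of `y₊` (negative speeds), the index `inr j` for those of `y₋` (positive speeds).
The state space is `L²(0,1)ⁿ`, with its product topology. -/
abbrev State (p m : ℕ) : Type := Fin p ⊕ Fin m → L2Space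

/-- The control space `L²(0,+∞)ᵐ`. -/
abbrev Control (m : ℕ) : Type := Fin m → L2Time

/-- The sign and ordering conditions on the speeds on `[0,1]`:
`λ₁ ≤ ⋯ ≤ λₚ < 0 < λₚ₊₁ ≤ ⋯ ≤ λₚ₊ₘ`. -/
def OrderedSpeeds {p m : ℕ} (lam : Fin p ⊕ Fin m → ℝ → ℝ) : Prop :=
  ∀ x ∈ Icc (0 : ℝ) 1,
    (∀ i i' : Fin p, i ≤ i' → lam (Sum.inl i) x ≤ lam (Sum.inl i') x) ∧
    (∀ i : Fin p, lam (Sum.inl i) x < 0) ∧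
    (∀ j : Fin m, 0 < lam (Sum.inr j) x) ∧
    (∀ j j' : Fin m, j ≤ j' → lam (Sum.inr j) x ≤ lam (Sum.inr j') x)

/-- Two speeds that agree somewhere on `[0,1]` agree everywhere on `[0,1]`. -/
def AgreeSomewhereImpliesEverywhere {p m : ℕ} (lam : Fin p ⊕ Fin m → ℝ → ℝ) : Prop :=
  ∀ i j : Fin p ⊕ Fin m, i ≠ j →
    (∃ x ∈ Icc (0 : ℝ) 1, lam i x = lam j x) → ∀ x ∈ Icc (0 : ℝ) 1, lam i x = lam j x

/-- The time `Tᵢ(Λ)` needed by the `i`-th characteristic to cross `[0,1]`. -/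
noncomputable def travelTime {p m : ℕ} (lam : Fin p ⊕ Fin m → ℝ → ℝ) : Fin p ⊕ Fin m → ℝ
  | Sum.inl i => -(∫ x in (0 : ℝ)..1, 1 / lam (Sum.inl i) x)
  | Sum.inr j => ∫ x in (0 : ℝ)..1, 1 / lam (Sum.inr j) x

/-- The matrix `R = -Λ₊(0) Q Λ₋(0)⁻¹`. -/
noncomputable def adjointBoundaryMatrix {p m : ℕ} (lam : Fin p ⊕ Fin m → ℝ → ℝ)
    (Q : Matrix (Fin p) (Fin m) ℝ) : Matrix (Fin p) (Fin m) ℝ :=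
  Matrix.of fun i j => -(lam (Sum.inl i) 0 * Q i j * (lam (Sum.inr j) 0)⁻¹)

/-- Test functions on `[0,T] × [0,1]`: restrictions of `C¹` functions of `(t,x) ∈ ℝ²` (on a closed
rectangle this is the same as being `C¹` up to the boundary) with `φ₊(·,1) = 0` and
`φ₋(·,0) = R* φ₊(·,0)` on `[0,T]`. -/
def IsTestFunction {p m : ℕ} (lam : Fin p ⊕ Fin m → ℝ → ℝ) (Q : Matrix (Fin p) (Fin m) ℝ) (T : ℝ)
    (φ : Fin p ⊕ Fin m → ℝ → ℝ → ℝ) : Prop :=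
  (∀ i, ContDiff ℝ 1 (fun z : ℝ × ℝ => φ i z.1 z.2)) ∧
  (∀ t ∈ Icc (0 : ℝ) T, ∀ i : Fin p, φ (Sum.inl i) t 1 = 0) ∧
  (∀ t ∈ Icc (0 : ℝ) T, ∀ j : Fin m,
    φ (Sum.inr j) t 0 = ∑ i : Fin p, adjointBoundaryMatrix lam Q i j * φ (Sum.inl i) t 0)

/-- `y` is a weak solution, on `[0,+∞)`, of
`∂ₜ y = Λ(x) ∂ₓ y + M(x) y`, `y₊(t,0) = Q y₋(t,0)`, `y₋(t,1) = u(t)`, `y(0,·) = y⁰`,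
where `Λ = diag(lam)`. Only the values of `y` at nonnegative times matter. -/
def IsWeakSolution {p m : ℕ} (lam : Fin p ⊕ Fin m → ℝ → ℝ)
    (M : ℝ → Matrix (Fin p ⊕ Fin m) (Fin p ⊕ Fin m) ℝ) (Q : Matrix (Fin p) (Fin m) ℝ)
    (y0 : State p m) (u : Control m) (y : ℝ → State p m) : Prop :=
  ContinuousOn y (Ici 0) ∧
  ∀ T : ℝ, 0 < T → ∀ φ : Fin p ⊕ Fin m → ℝ → ℝ → ℝ, IsTestFunction lam Q T φ →
    (∫ x in Ioo (0 : ℝ) 1, ∑ i, y T i x * φ i T x) -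
      (∫ x in Ioo (0 : ℝ) 1, ∑ i, y0 i x * φ i 0 x) =
    (∫ t in Ioo (0 : ℝ) T, ∫ x in Ioo (0 : ℝ) 1, ∑ i, y t i x *
      (deriv (fun s => φ i s x) t - lam i x * deriv (fun ξ => φ i t ξ) x
        + (-(deriv (lam i) x * φ i t x) + ∑ k, M x k i * φ k t x))) +
    ∫ t in Ioo (0 : ℝ) T, ∑ j : Fin m, u j t * (lam (Sum.inr j) 1 * φ (Sum.inr j) t 1)

/-- Exact controllability in time `T`. -/
def ExactlyControllable {p m : ℕ} (lam : Fin p ⊕ Fin m → ℝ → ℝ)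
    (M : ℝ → Matrix (Fin p ⊕ Fin m) (Fin p ⊕ Fin m) ℝ) (Q : Matrix (Fin p) (Fin m) ℝ)
    (T : ℝ) : Prop :=
  ∀ y0 y1 : State p m, ∃ u : Control m, ∃ y : ℝ → State p m,
    IsWeakSolution lam M Q y0 u y ∧ y T = y1

/-- The minimal time for exact controllability, in `[0,+∞]`. -/
noncomputable def minimalTime {p m : ℕ} (lam : Fin p ⊕ Fin m → ℝ → ℝ)
    (M : ℝ → Matrix (Fin p ⊕ Fin m) (Fin p ⊕ Fin m) ℝ) (Q : Matrix (Fin p) (Fin m) ℝ) : ℝ≥0∞ :=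
  sInf (ENNReal.ofReal '' {T : ℝ | 0 < T ∧ ExactlyControllable lam M Q T})

/-- The speeds `(-1, λ₂(x), 1/2, 1)`, with `p = m = 2`. -/
noncomputable def exampleSpeeds (lam2 : ℝ → ℝ) : Fin 2 ⊕ Fin 2 → ℝ → ℝ :=
  Sum.elim ![fun _ => -1, lam2] ![fun _ => 1 / 2, fun _ => 1]

/-- The internal coupling of the first two equations: `+ a(x) y₂` in the first one,
`- a(x) y₁` in the second one. -/
def exampleCoupling (a : ℝ → ℝ) (x : ℝ) : Matrix (Fin 2 ⊕ Fin 2) (Fin 2 ⊕ Fin 2) ℝ :=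
  Matrix.fromBlocks !![0, a x; -a x, 0] 0 0 0

end HyperbolicControl

/-! Put `θ(x) = ∫₀ˣ a` and `σ(x) = -∫₀ˣ 1/λ₂`. On `[0,1/2]` the first two components travel at the
same speed `-1`, so `σ(x) = x` there, and the coupling only rotates them by the angle `θ`. Hence for
all `G₁, G₂ ∈ L²(ℝ)` the functions `y₁ = cos θ · G₁(t-x) + sin θ · G₂(t-x)`, `y₂ = -sin θ · G₁(t-σ)
+ cos θ · G₂(t-σ)`, `y₃ = G₁(t+2x)`, `y₄ = G₂(t+x)` solve the system with controls `G₁(t+2)` and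
`G₂(t+1)` (`Coefficients.isWeakSolution`). Beyond `1/2` the angle is `π/2`: the signal of the slow
component `y₃` has been handed over to the slow component `y₂` (crossing time `2 + 2`), and the fast
signals are paired likewise (`1 + 1`). Without coupling slow is paired with fast, `2 + 1` and `1 +
2`. This explains the thresholds `4` and `3`.

Sufficiency: every state is produced at time `0` by profiles of bounded support (`Generates`).
Adding the profiles of `y⁰` to those of `y¹` delayed by `T` joins the two states once `T` reaches
the threshold (`exactlyControllable_of_generates`).

Necessity is by duality. Transporting a bump `g` along the adjoint system gives a test function on
which the control has no effect, provided the support of `g` lies in `(T-2, 2)` in the coupled case,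
or in `(T-1, 2)` in the free case. Below the threshold this window is nonempty. Starting from `0`,
every `y(T)` is then orthogonal to a fixed nonzero state, which is therefore not reachable
(`integral_adjointState_eq_zero`, `not_exactlyControllable`).

Uniqueness of weak solutions is never needed: sufficiency exhibits one solution, and necessity
applies to every solution. The analytic work comes from the low regularity. Profiles are only `L²`,
so the balance law of a wave is obtained by density (`wave_identity`). Amplitudes are only
Lipschitz, so adjoint states are smoothed before they are used as test functions
(`exists_contDiff_approx`). -/

namespace HyperbolicControl

open Filter Topology

/-! ### Composition with expanding phases, and continuity of translations in `L²`. -/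

/-- Lebesgue measure on `(0,1)`. -/
noncomputable abbrev mu01 : Measure ℝ := volume.restrict (Ioo (0 : ℝ) 1)

instance isProbabilityMeasure_mu01 : IsProbabilityMeasure mu01 :=
  ⟨by simp [mu01]⟩

/-- Lebesgue measure on `ℝ` is the one-dimensional Hausdorff measure, and preimages under an
antilipschitz map have controlled diameters. All phases below have slope `1/λ` with `|λ| ≤ 1`, so `K
= 1` and composition does not increase the `L²` norm. -/
theorem map_volume_le_of_antilipschitz {K : ℝ≥0} {τ : ℝ → ℝ} (hτ : AntilipschitzWith K τ)
    (hm : Measurable τ) : Measure.map τ volume ≤ (K : ℝ≥0∞) • (volume : Measure ℝ) := by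
  refine Measure.le_iff.2 fun s hs => ?_
  rw [Measure.map_apply hm hs]
  have := hτ.hausdorffMeasure_preimage_le (d := 1) zero_le_one s
  simpa [hausdorffMeasure_real] using this

theorem memLp_comp_of_antilipschitz {K : ℝ≥0} {τ f : ℝ → ℝ} (hτ : AntilipschitzWith K τ)
    (hm : Measurable τ) (hf : MemLp f 2 volume) : MemLp (fun x => f (τ x)) 2 volume := by
  have h1 : MemLp f 2 (Measure.map τ volume) :=
    hf.of_measure_le_smul ENNReal.coe_ne_top (map_volume_le_of_antilipschitz hτ hm)
  exact h1.comp_of_map hm.aemeasurable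

theorem eLpNorm_comp_le_of_antilipschitz {τ f : ℝ → ℝ} (hτ : AntilipschitzWith 1 τ)
    (hm : Measurable τ) (hf : AEStronglyMeasurable f volume) :
    eLpNorm (fun x => f (τ x)) 2 volume ≤ eLpNorm f 2 volume := by
  have hle : Measure.map τ volume ≤ volume := by
    simpa using map_volume_le_of_antilipschitz hτ hm
  have h1 : AEStronglyMeasurable f (Measure.map τ volume) :=
    hf.mono_ac (Measure.absolutelyContinuous_of_le hle)
  have := eLpNorm_map_measure (p := 2) h1 hm.aemeasurable
  calc eLpNorm (fun x => f (τ x)) 2 volume = eLpNorm f 2 (Measure.map τ volume) := this.symm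
    _ ≤ _ := eLpNorm_mono_measure _ hle

theorem antilipschitz_const_add {K : ℝ≥0} {τ : ℝ → ℝ} (hτ : AntilipschitzWith K τ) (t : ℝ) :
    AntilipschitzWith K (fun x => t + τ x) := by
  refine AntilipschitzWith.of_le_mul_dist fun x y => ?_
  simpa using hτ.le_mul_dist x y

theorem memLp_wave {τ f : ℝ → ℝ} (hτ : AntilipschitzWith 1 τ) (hm : Measurable τ)
    (hf : MemLp f 2 volume) (t : ℝ) : MemLp (fun x => f (t + τ x)) 2 mu01 :=
  (memLp_comp_of_antilipschitz (antilipschitz_const_add hτ t) (hm.const_add t) hf).restrict _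

theorem eLpNorm_wave_le {τ f : ℝ → ℝ} (hτ : AntilipschitzWith 1 τ) (hm : Measurable τ)
    (hf : AEStronglyMeasurable f volume) (t : ℝ) :
    eLpNorm (fun x => f (t + τ x)) 2 mu01 ≤ eLpNorm f 2 volume :=
  (eLpNorm_mono_measure _ Measure.restrict_le_self).trans
    (eLpNorm_comp_le_of_antilipschitz (antilipschitz_const_add hτ t) (hm.const_add t) hf)

/-- Translations act continuously on `L²(ℝ)`. -/
theorem tendsto_eLpNorm_translate {f : ℝ → ℝ} (hf : MemLp f 2 volume) (t₀ : ℝ) :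
    Tendsto (fun t => eLpNorm (fun s => f (t + s) - f (t₀ + s)) 2 volume) (𝓝 t₀) (𝓝 0) := by
  have hmp : ∀ t : ℝ, MeasurePreserving (fun s : ℝ => t + s) volume volume :=
    fun t => measurePreserving_add_left volume t
  have hc : Continuous fun t : ℝ => (⟨fun s => t + s, by fun_prop⟩ : C(ℝ, ℝ)) :=
    ContinuousMap.continuous_of_continuous_uncurry _ 
      (by exact continuous_fst.add continuous_snd)
  have h2 : Continuous fun t : ℝ => Lp.compMeasurePreserving (fun s : ℝ => t + s) (hmp t)
      (hf.toLp f) :=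
    (continuous_const (y := hf.toLp f)).compMeasurePreservingLp hc hmp (by simp)
  have h3 := h2.tendsto t₀
  simp only [Lp.toLp_compMeasurePreserving] at h3
  rw [Lp.tendsto_Lp_iff_tendsto_eLpNorm''] at h3
  simpa [Function.comp_def, Pi.sub_def] using h3

theorem tendsto_eLpNorm_wave {τ f : ℝ → ℝ} (hτ : AntilipschitzWith 1 τ) (hm : Measurable τ)
    (hf : MemLp f 2 volume) (t₀ : ℝ) :
    Tendsto (fun t => eLpNorm (fun x => f (t + τ x) - f (t₀ + τ x)) 2 mu01) (𝓝 t₀) (𝓝 0) := by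
  refine tendsto_of_tendsto_of_tendsto_of_le_of_le tendsto_const_nhds
    (tendsto_eLpNorm_translate hf t₀) (fun t => zero_le) fun t => ?_
  have hmeas : ∀ t : ℝ, AEStronglyMeasurable (fun s => f (t + s)) volume := fun t =>
    (hf.comp_measurePreserving (measurePreserving_add_left volume t)).aestronglyMeasurable
  -- The translations are absorbed in the profile `f(t + ·) - f(t₀ + ·)`, hence the time `0`.
  simpa [Pi.sub_def] using eLpNorm_wave_le hτ hm ((hmeas t).sub (hmeas t₀)) 0

/-! ### Pairings of `L²` functions with bounded weights. -/

section Pairing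

variable {α ι : Type*} [MeasurableSpace α] {μ : Measure α}

theorem abs_integral_mul_le [IsProbabilityMeasure μ] {Y w : α → ℝ} {C : ℝ}
    (hY : MemLp Y 2 μ) (hb : ∀ᵐ x ∂μ, |w x| ≤ C) :
    |∫ x, Y x * w x ∂μ| ≤ C * (eLpNorm Y 2 μ).toReal := by
  have hY1 : MemLp Y 1 μ := hY.mono_exponent (by norm_num)
  have hC : 0 ≤ C := by
    obtain ⟨x, hx⟩ := hb.exists
    exact (abs_nonneg _).trans hx
  calc |∫ x, Y x * w x ∂μ| ≤ ∫ x, C * ‖Y x‖ ∂μ := by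
        rw [← Real.norm_eq_abs]
        refine norm_integral_le_of_norm_le ((memLp_one_iff_integrable.1 hY1).norm.const_mul C) ?_
        filter_upwards [hb] with x hx
        rw [norm_mul, mul_comm]
        exact mul_le_mul_of_nonneg_right hx (norm_nonneg _)
    _ = C * (eLpNorm Y 1 μ).toReal := by
        rw [integral_const_mul, integral_norm_eq_lintegral_enorm hY.aestronglyMeasurable,
          eLpNorm_one_eq_lintegral_enorm]
    _ ≤ _ := by
        refine mul_le_mul_of_nonneg_left (ENNReal.toReal_mono hY.eLpNorm_ne_top ?_) hC
        exact eLpNorm_le_eLpNorm_of_exponent_le (by norm_num) hY.aestronglyMeasurable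

/-- Split `Yₙ wₙ = (Yₙ - Y₀) wₙ + Y₀ wₙ`. The first part is small in `L¹` because the weights are
uniformly bounded, and the second converges by dominated convergence. This limit is the workhorse of
all density and continuity arguments below. -/
theorem tendsto_integral_mul [IsFiniteMeasure μ] {l : Filter ι} [l.IsCountablyGenerated]
    {Y w : ι → α → ℝ} {Y₀ w₀ : α → ℝ} {C : ℝ} (hY₀ : MemLp Y₀ 2 μ) (hY : ∀ n, MemLp (Y n) 2 μ)
    (hlim : Tendsto (fun n => eLpNorm (fun x => Y n x - Y₀ x) 2 μ) l (𝓝 0))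
    (hw : ∀ n, AEStronglyMeasurable (w n) μ) (hb : ∀ᶠ n in l, ∀ᵐ x ∂μ, |w n x| ≤ C)
    (hwlim : ∀ᵐ x ∂μ, Tendsto (fun n => w n x) l (𝓝 (w₀ x))) :
    Tendsto (fun n => ∫ x, Y n x * w n x ∂μ) l (𝓝 (∫ x, Y₀ x * w₀ x ∂μ)) := by
  have i1 : ∀ {Z : α → ℝ}, MemLp Z 2 μ → Integrable Z μ := fun h =>
    memLp_one_iff_integrable.1 (h.mono_exponent (by norm_num))
  have hsub : ∀ n, MemLp (fun x => Y n x - Y₀ x) 2 μ := fun n => (hY n).sub hY₀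
  have e1 : Tendsto (fun n => ∫ x, Y₀ x * w n x ∂μ) l (𝓝 (∫ x, Y₀ x * w₀ x ∂μ)) := by
    refine tendsto_integral_filter_of_dominated_convergence (fun x => ‖Y₀ x‖ * C)
      (Eventually.of_forall fun n => hY₀.aestronglyMeasurable.mul (hw n)) ?_
      ((i1 hY₀).norm.mul_const C) ?_
    · filter_upwards [hb] with n hn
      filter_upwards [hn] with x hx
      rw [norm_mul]
      exact mul_le_mul_of_nonneg_left hx (norm_nonneg _)
    · filter_upwards [hwlim] with x hx
      exact hx.const_mul _
  have e2 : Tendsto (fun n => ∫ x, (Y n x - Y₀ x) * w n x ∂μ) l (𝓝 0) := by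
    have hn1 : Tendsto (fun n => eLpNorm (fun x => Y n x - Y₀ x) 1 μ) l (𝓝 0) := by
      have h2 : Tendsto (fun n => eLpNorm (fun x => Y n x - Y₀ x) 2 μ *
          μ Set.univ ^ (1 / (1 : ℝ≥0∞).toReal - 1 / (2 : ℝ≥0∞).toReal)) l (𝓝 (0 * μ Set.univ ^ (1 / (1 : ℝ≥0∞).toReal - 1 / (2 : ℝ≥0∞).toReal))) := by
        refine ENNReal.Tendsto.mul_const hlim (Or.inr ?_)
        exact ENNReal.rpow_ne_top_of_nonneg (by norm_num) (measure_ne_top _ _)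
      rw [zero_mul] at h2
      exact tendsto_of_tendsto_of_tendsto_of_le_of_le tendsto_const_nhds h2
        (fun n => zero_le) fun n => eLpNorm_le_eLpNorm_mul_rpow_measure_univ
          (by norm_num) (hsub n).aestronglyMeasurable
    have hn2 : Tendsto (fun n => C * (eLpNorm (fun x => Y n x - Y₀ x) 1 μ).toReal) l (𝓝 0) := by
      have := ((ENNReal.tendsto_toReal ENNReal.zero_ne_top).comp hn1).const_mul C
      simpa using this
    refine squeeze_zero_norm' ?_ hn2
    filter_upwards [hb] with n hn
    calc ‖∫ x, (Y n x - Y₀ x) * w n x ∂μ‖ ≤ ∫ x, C * ‖Y n x - Y₀ x‖ ∂μ := by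
          refine norm_integral_le_of_norm_le ((i1 (hsub n)).norm.const_mul C) ?_
          filter_upwards [hn] with x hx
          rw [norm_mul, mul_comm]
          exact mul_le_mul_of_nonneg_right hx (norm_nonneg _)
      _ = _ := by
          rw [integral_const_mul, integral_norm_eq_lintegral_enorm (hsub n).aestronglyMeasurable,
            eLpNorm_one_eq_lintegral_enorm]
  have e3 := e2.add e1
  rw [zero_add] at e3
  refine e3.congr' ?_
  filter_upwards [hb] with n hn
  have hbdd : ∀ {Z : α → ℝ}, MemLp Z 2 μ → Integrable (fun x => Z x * w n x) μ := fun h =>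
    (i1 h).mul_bdd (hw n) hn
  rw [← integral_add (hbdd (hsub n)) (hbdd hY₀)]
  exact integral_congr_ae (Eventually.of_forall fun x => by ring)

end Pairing

/-- Functions of `(t,x)` that are measurable in `x`, continuous in `t` and bounded on
`[0,T] × (0,1)`. -/
def IsWeight (T : ℝ) (w : ℝ → ℝ → ℝ) : Prop :=
  (∀ t, Measurable (w t)) ∧ (∀ x, Continuous fun t => w t x) ∧
    ∃ W, ∀ t ∈ Icc 0 T, ∀ x ∈ Ioo (0 : ℝ) 1, |w t x| ≤ W

namespace IsWeight

variable {T : ℝ} {w v : ℝ → ℝ → ℝ}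

theorem add (hw : IsWeight T w) (hv : IsWeight T v) : IsWeight T fun t x => w t x + v t x := by
  obtain ⟨a1, a2, W, a3⟩ := hw
  obtain ⟨b1, b2, V, b3⟩ := hv
  refine ⟨fun t => (a1 t).add (b1 t), fun x => (a2 x).add (b2 x), W + V, fun t ht x hx => ?_⟩
  exact (abs_add_le _ _).trans (add_le_add (a3 t ht x hx) (b3 t ht x hx))

theorem mul (hw : IsWeight T w) (hv : IsWeight T v) : IsWeight T fun t x => w t x * v t x := by
  obtain ⟨a1, a2, W, a3⟩ := hw
  obtain ⟨b1, b2, V, b3⟩ := hv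
  refine ⟨fun t => (a1 t).mul (b1 t), fun x => (a2 x).mul (b2 x), W * V, fun t ht x hx => ?_⟩
  rw [abs_mul]
  exact mul_le_mul (a3 t ht x hx) (b3 t ht x hx) (abs_nonneg _)
    ((abs_nonneg _).trans (a3 t ht x hx))

theorem of_bounded {b : ℝ → ℝ} (hm : Measurable b) {B : ℝ} (hb : ∀ x ∈ Ioo (0 : ℝ) 1, |b x| ≤ B) :
    IsWeight T fun _ x => b x :=
  ⟨fun _ => hm, fun _ => continuous_const, B, fun _ _ x hx => hb x hx⟩

theorem of_continuous (hw : Continuous fun z : ℝ × ℝ => w z.1 z.2) : IsWeight T w := by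
  refine ⟨fun t => (hw.comp (by fun_prop : Continuous fun x : ℝ => (t, x))).measurable,
    fun x => hw.comp (by fun_prop : Continuous fun t : ℝ => (t, x)), ?_⟩
  obtain ⟨W, hW⟩ := (isCompact_Icc.prod isCompact_Icc :
    IsCompact (Icc 0 T ×ˢ Icc (0 : ℝ) 1)).exists_bound_of_continuousOn hw.continuousOn
  exact ⟨W, fun t ht x hx => hW (t, x) ⟨ht, Ioo_subset_Icc_self hx⟩⟩

theorem neg (hw : IsWeight T w) : IsWeight T fun t x => -w t x := by
  obtain ⟨a1, a2, W, a3⟩ := hw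
  exact ⟨fun t => (a1 t).neg, fun x => (a2 x).neg, W, fun t ht x hx => by
    rw [abs_neg]; exact a3 t ht x hx⟩

theorem sub (hw : IsWeight T w) (hv : IsWeight T v) : IsWeight T fun t x => w t x - v t x := by
  simpa [sub_eq_add_neg] using hw.add hv.neg

theorem integrable_mul (hw : IsWeight T w) {t : ℝ} (ht : t ∈ Icc 0 T) {Y : ℝ → ℝ}
    (hY : MemLp Y 2 mu01) : Integrable (fun x => Y x * w t x) mu01 := by
  obtain ⟨a1, a2, W, a3⟩ := hw
  exact (memLp_one_iff_integrable.1 (hY.mono_exponent (by norm_num))).mul_bdd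
    (a1 t).aestronglyMeasurable
    ((ae_restrict_iff' measurableSet_Ioo).2 (Eventually.of_forall fun x hx => a3 t ht x hx))

/-- Supplies measurability and integrability in `t` of the inner integrals, without any joint
measurability of `Y` in `(t, x)`. -/
theorem continuousOn_integral (hw : IsWeight T w) {Y : ℝ → ℝ → ℝ}
    (hY : ∀ t, MemLp (Y t) 2 mu01)
    (hYc : ∀ t₀ ∈ Icc 0 T, Tendsto (fun t => eLpNorm (fun x => Y t x - Y t₀ x) 2 mu01)
      (𝓝[Icc 0 T] t₀) (𝓝 0)) :
    ContinuousOn (fun t => ∫ x in Ioo (0 : ℝ) 1, Y t x * w t x) (Icc 0 T) := by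
  obtain ⟨a1, a2, W, a3⟩ := hw
  intro t₀ ht₀
  refine tendsto_integral_mul (C := W) (hY t₀) hY (hYc t₀ ht₀)
    (fun t => (a1 t).aestronglyMeasurable) ?_ ?_
  · filter_upwards [self_mem_nhdsWithin] with t ht
    exact (ae_restrict_iff' measurableSet_Ioo).2 (Eventually.of_forall fun x hx => a3 t ht x hx)
  · exact Eventually.of_forall fun x => ((a2 x).tendsto t₀).mono_left nhdsWithin_le_nhds

end IsWeight

theorem continuousOn_wave_integral {T : ℝ} {w : ℝ → ℝ → ℝ} (hw : IsWeight T w) {τ f : ℝ → ℝ}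
    (hτ : AntilipschitzWith 1 τ) (hm : Measurable τ) (hf : MemLp f 2 volume) :
    ContinuousOn (fun t => ∫ x in Ioo (0 : ℝ) 1, f (t + τ x) * w t x) (Icc 0 T) :=
  hw.continuousOn_integral (fun t => memLp_wave hτ hm hf t) fun t₀ _ =>
    (tendsto_eLpNorm_wave hτ hm hf t₀).mono_left nhdsWithin_le_nhds

section Partials

variable {φ : ℝ → ℝ → ℝ}

theorem hasDerivAt_fst_of_contDiff (hφ : ContDiff ℝ 1 fun z : ℝ × ℝ => φ z.1 z.2) (t x : ℝ) :
    HasDerivAt (fun s => φ s x) (fderiv ℝ (fun z : ℝ × ℝ => φ z.1 z.2) (t, x) (1, 0)) t := by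
  have h := (hφ.differentiable (by norm_num) (t, x)).hasFDerivAt
  exact h.comp_hasDerivAt t ((hasDerivAt_id t).prodMk (hasDerivAt_const t x))

theorem hasDerivAt_snd_of_contDiff (hφ : ContDiff ℝ 1 fun z : ℝ × ℝ => φ z.1 z.2) (t x : ℝ) :
    HasDerivAt (fun ξ => φ t ξ) (fderiv ℝ (fun z : ℝ × ℝ => φ z.1 z.2) (t, x) (0, 1)) x := by
  have h := (hφ.differentiable (by norm_num) (t, x)).hasFDerivAt
  exact h.comp_hasDerivAt x ((hasDerivAt_const x t).prodMk (hasDerivAt_id x))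

theorem continuous_deriv_fst (hφ : ContDiff ℝ 1 fun z : ℝ × ℝ => φ z.1 z.2) :
    Continuous fun z : ℝ × ℝ => deriv (fun s => φ s z.2) z.1 := by
  have : (fun z : ℝ × ℝ => deriv (fun s => φ s z.2) z.1) =
      fun z => fderiv ℝ (fun z : ℝ × ℝ => φ z.1 z.2) z (1, 0) :=
    funext fun z => (hasDerivAt_fst_of_contDiff hφ z.1 z.2).deriv
  rw [this]
  exact (hφ.continuous_fderiv (by norm_num)).clm_apply continuous_const

theorem continuous_deriv_snd (hφ : ContDiff ℝ 1 fun z : ℝ × ℝ => φ z.1 z.2) :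
    Continuous fun z : ℝ × ℝ => deriv (fun ξ => φ z.1 ξ) z.2 := by
  have : (fun z : ℝ × ℝ => deriv (fun ξ => φ z.1 ξ) z.2) =
      fun z => fderiv ℝ (fun z : ℝ × ℝ => φ z.1 z.2) z (0, 1) :=
    funext fun z => (hasDerivAt_snd_of_contDiff hφ z.1 z.2).deriv
  rw [this]
  exact (hφ.continuous_fderiv (by norm_num)).clm_apply continuous_const

end Partials

/-! ### The balance law of a single wave. -/

/-- The weight against which a wave `c(x) f(t + τ(x))` with speed `lam` is integrated in the weak
formulation. -/
noncomputable def waveWeight (lam c : ℝ → ℝ) (φ : ℝ → ℝ → ℝ) (t x : ℝ) : ℝ :=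
  c x * (deriv (fun s => φ s x) t - lam x * deriv (fun ξ => φ t ξ) x - deriv lam x * φ t x)
    - deriv c x * lam x * φ t x

/-- The boundary flux of a wave. -/
def waveFlux (lam c τ f : ℝ → ℝ) (φ : ℝ → ℝ → ℝ) (t : ℝ) : ℝ :=
  f (t + τ 1) * (c 1 * lam 1 * φ t 1) - f (t + τ 0) * (c 0 * lam 0 * φ t 0)

section Wave

variable {lam c τ : ℝ → ℝ} {Kl Kc : ℝ≥0} {φ : ℝ → ℝ → ℝ}

theorem isWeight_waveWeight (hlam : LipschitzWith Kl lam) (hc : LipschitzWith Kc c)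
    (hφ : ContDiff ℝ 1 fun z : ℝ × ℝ => φ z.1 z.2) (T : ℝ) :
    IsWeight T (waveWeight lam c φ) := by
  have h1 : IsWeight T fun t x => deriv (fun s => φ s x) t :=
    .of_continuous (continuous_deriv_fst hφ)
  have h2 : IsWeight T fun t x => deriv (fun ξ => φ t ξ) x :=
    .of_continuous (continuous_deriv_snd hφ)
  have h3 : IsWeight T φ := .of_continuous hφ.continuous
  have hl : IsWeight T fun _ x => lam x :=
    .of_continuous (hlam.continuous.comp continuous_snd)
  have hcw : IsWeight T fun _ x => c x := .of_continuous (hc.continuous.comp continuous_snd)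
  have hl' : IsWeight T fun _ x => deriv lam x :=
    .of_bounded (measurable_deriv lam) fun x _ => norm_deriv_le_of_lipschitz hlam
  have hc' : IsWeight T fun _ x => deriv c x :=
    .of_bounded (measurable_deriv c) fun x _ => norm_deriv_le_of_lipschitz hc
  exact (hcw.mul ((h1.sub (hl.mul h2)).sub (hl'.mul h3))).sub ((hc'.mul hl).mul h3)

theorem integral_Ioo_eq_intervalIntegral {a b : ℝ} (hab : a ≤ b) (g : ℝ → ℝ) :
    ∫ x in Ioo a b, g x = ∫ x in a..b, g x := by
  rw [intervalIntegral.integral_of_le hab, integral_Ioc_eq_integral_Ioo]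

/-- Integration by parts along a smooth wave at a fixed time. -/
theorem integral_wave_by_parts (hlam : LipschitzWith Kl lam) (hc : LipschitzWith Kc c)
    (hne : ∀ x, lam x ≠ 0) (hτ : ∀ x, HasDerivAt τ (1 / lam x) x)
    (hφ : ContDiff ℝ 1 fun z : ℝ × ℝ => φ z.1 z.2) {f : ℝ → ℝ} (hf : ContDiff ℝ 1 f)
    {t : ℝ} (ht : 0 ≤ t) :
    ∫ x in (0 : ℝ)..1, c x * (deriv f (t + τ x) * φ t x +
        f (t + τ x) * deriv (fun s => φ s x) t) =
      (∫ x in (0 : ℝ)..1, f (t + τ x) * waveWeight lam c φ t x) + waveFlux lam c τ f φ t := by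
  have hτ1 : ContDiff ℝ 1 τ := by
    rw [contDiff_one_iff_deriv]
    refine ⟨fun x => (hτ x).differentiableAt, ?_⟩
    have : deriv τ = fun x => 1 / lam x := funext fun x => (hτ x).deriv
    rw [this]
    exact continuous_const.div hlam.continuous hne
  have hF1 : ContDiff ℝ 1 fun x => f (t + τ x) := hf.comp (contDiff_const.add hτ1)
  have hφ1 : ContDiff ℝ 1 fun x => φ t x := hφ.comp (contDiff_const.prodMk contDiff_id)
  have ac : ∀ {g : ℝ → ℝ}, ContDiff ℝ 1 g → AbsolutelyContinuousOnInterval g 0 1 := by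
    intro g hg
    obtain ⟨K, hK⟩ := hg.contDiffOn.exists_lipschitzOnWith (n := 1) (by norm_num)
      (convex_uIcc (0 : ℝ) 1) isCompact_uIcc
    exact hK.absolutelyContinuousOnInterval
  -- The amplitude and the speed are only Lipschitz, so the integration by parts is that of
  -- absolutely continuous functions and the product rule holds almost everywhere.
  have hg : AbsolutelyContinuousOnInterval (fun x => c x * lam x * φ t x) 0 1 :=
    ((hc.lipschitzOnWith.absolutelyContinuousOnInterval).fun_mul
      hlam.lipschitzOnWith.absolutelyContinuousOnInterval).fun_mul (ac hφ1)
  have key := (ac hF1).integral_deriv_mul_eq_sub hg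
  have hcd : ∀ᵐ x : ℝ, DifferentiableAt ℝ c x := hc.ae_differentiableAt_real
  have hld : ∀ᵐ x : ℝ, DifferentiableAt ℝ lam x := hlam.ae_differentiableAt_real
  have hae : ∀ᵐ x : ℝ, x ∈ uIoc (0 : ℝ) 1 →
      deriv (fun x => f (t + τ x)) x * (c x * lam x * φ t x) +
        f (t + τ x) * deriv (fun x => c x * lam x * φ t x) x =
      c x * (deriv f (t + τ x) * φ t x + f (t + τ x) * deriv (fun s => φ s x) t) -
        f (t + τ x) * waveWeight lam c φ t x := by
    filter_upwards [hcd, hld] with x h1 h2 _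
    have hd1 : deriv (fun x => f (t + τ x)) x = deriv f (t + τ x) * (1 / lam x) := by
      have h3 : HasDerivAt f (deriv f (t + τ x)) (t + τ x) :=
        (hf.differentiable (by norm_num) _).hasDerivAt
      exact (h3.comp x ((hτ x).const_add t)).deriv
    have hd2 : deriv (fun x => c x * lam x * φ t x) x =
        (deriv c x * lam x + c x * deriv lam x) * φ t x +
          c x * lam x * deriv (fun ξ => φ t ξ) x :=
      ((h1.hasDerivAt.mul h2.hasDerivAt).mul
        (hφ1.differentiable (by norm_num) x).hasDerivAt).deriv
    rw [hd1, hd2, waveWeight]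
    field_simp [hne x]
    ring
  rw [intervalIntegral.integral_congr_ae hae, intervalIntegral.integral_sub] at key
  · rw [waveFlux]; linarith
  · refine Continuous.intervalIntegrable ?_ _ _
    have := continuous_deriv_fst hφ
    have h4 : Continuous fun x => deriv (fun s => φ s x) t :=
      this.comp (by fun_prop : Continuous fun x : ℝ => (t, x))
    have h5 : Continuous (deriv f) := hf.continuous_deriv (by norm_num)
    have h6 := hc.continuous
    have h7 := hφ1.continuous
    have h8 := hf.continuous
    fun_prop
  · rw [intervalIntegrable_iff_integrableOn_Ioo_of_le zero_le_one]
    -- Any horizon containing `t` would do.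
    have hw := isWeight_waveWeight hlam hc hφ |t|
    obtain ⟨B, hB⟩ := isCompact_Icc.exists_bound_of_continuousOn
      (hF1.continuous.continuousOn (s := Icc (0 : ℝ) 1))
    refine hw.integrable_mul (t := t) ⟨ht, le_abs_self t⟩ ?_
    exact MemLp.of_bound hF1.continuous.aestronglyMeasurable B
      ((ae_restrict_iff' measurableSet_Ioo).2 (Eventually.of_forall fun x hx =>
        hB x (Ioo_subset_Icc_self hx)))

theorem continuous_waveFlux (hφ : ContDiff ℝ 1 fun z : ℝ × ℝ => φ z.1 z.2) {f : ℝ → ℝ}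
    (hf : Continuous f) : Continuous (waveFlux lam c τ f φ) := by
  have h : ∀ x, Continuous fun t => φ t x := fun x =>
    hφ.continuous.comp (by fun_prop : Continuous fun t : ℝ => (t, x))
  have h0 := h 0
  have h1 := h 1
  unfold waveFlux
  fun_prop

/-- The balance law of a smooth wave tested against a `C¹` function. -/
theorem wave_identity_of_contDiff (hlam : LipschitzWith Kl lam) (hc : LipschitzWith Kc c)
    (hne : ∀ x, lam x ≠ 0) (hτ : ∀ x, HasDerivAt τ (1 / lam x) x) (hanti : AntilipschitzWith 1 τ)
    (hφ : ContDiff ℝ 1 fun z : ℝ × ℝ => φ z.1 z.2) {f : ℝ → ℝ} (hf : ContDiff ℝ 1 f)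
    (hf2 : MemLp f 2 volume) {T : ℝ} (hT : 0 < T) :
    (∫ x in Ioo (0 : ℝ) 1, f (T + τ x) * (c x * φ T x)) -
        (∫ x in Ioo (0 : ℝ) 1, f (0 + τ x) * (c x * φ 0 x)) =
      (∫ t in Ioo (0 : ℝ) T, ∫ x in Ioo (0 : ℝ) 1, f (t + τ x) * waveWeight lam c φ t x) +
        ∫ t in Ioo (0 : ℝ) T, waveFlux lam c τ f φ t := by
  have hτc : Continuous τ := continuous_iff_continuousAt.2 fun x => (hτ x).continuousAt
  have hφc := hφ.continuous
  have hfc := hf.continuous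
  have hf' : Continuous (deriv f) := hf.continuous_deriv (by norm_num)
  have hcc := hc.continuous
  have hφt := continuous_deriv_fst hφ
  have hcont : Continuous fun z : ℝ × ℝ => c z.2 * (deriv f (z.1 + τ z.2) * φ z.1 z.2 +
      f (z.1 + τ z.2) * deriv (fun s => φ s z.2) z.1) := by fun_prop
  have hcontS : ∀ s, Continuous fun x => f (s + τ x) * (c x * φ s x) := fun s => by
    have : Continuous fun x => φ s x := hφc.comp (by fun_prop : Continuous fun x : ℝ => (s, x))
    fun_prop
  have hx : ∀ x, f (T + τ x) * (c x * φ T x) - f (0 + τ x) * (c x * φ 0 x) =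
      ∫ t in (0 : ℝ)..T, c x * (deriv f (t + τ x) * φ t x +
        f (t + τ x) * deriv (fun s => φ s x) t) := by
    intro x
    have hd : ∀ t, HasDerivAt (fun t => f (t + τ x) * (c x * φ t x))
        (c x * (deriv f (t + τ x) * φ t x + f (t + τ x) * deriv (fun s => φ s x) t)) t := by
      intro t
      have h3 : HasDerivAt f (deriv f (t + τ x)) (t + τ x) :=
        (hf.differentiable (by norm_num) _).hasDerivAt
      have h4 := h3.comp t ((hasDerivAt_id t).add_const (τ x))
      have h5 := (hasDerivAt_fst_of_contDiff hφ t x).differentiableAt.hasDerivAt.const_mul (c x)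
      have h6 := h4.mul h5
      refine h6.congr_deriv ?_
      simp only [Function.comp_apply, id]
      ring
    refine (intervalIntegral.integral_eq_sub_of_hasDerivAt (fun t _ => hd t) ?_).symm
    exact (hcont.comp (by fun_prop : Continuous fun t : ℝ => (t, x))).intervalIntegrable _ _
  simp only [integral_Ioo_eq_intervalIntegral zero_le_one, integral_Ioo_eq_intervalIntegral hT.le]
  rw [← intervalIntegral.integral_sub ((hcontS T).intervalIntegrable _ _)
    ((hcontS 0).intervalIntegrable _ _), ← intervalIntegral.integral_add]
  · simp_rw [hx]
    rw [intervalIntegral_intervalIntegral_swap]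
    · refine intervalIntegral.integral_congr fun t ht => ?_
      rw [uIcc_of_le hT.le] at ht
      exact integral_wave_by_parts hlam hc hne hτ hφ hf ht.1
    · rw [uIoc_of_le hT.le, uIoc_of_le zero_le_one]
      have h1 : Continuous (Function.uncurry fun x t => c x * (deriv f (t + τ x) * φ t x +
          f (t + τ x) * deriv (fun s => φ s x) t)) := hcont.comp continuous_swap
      exact (h1.continuousOn.integrableOn_compact (isCompact_Icc.prod isCompact_Icc)).mono_set
        (prod_mono Ioc_subset_Icc_self Ioc_subset_Icc_self)
  · refine ContinuousOn.intervalIntegrable ?_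
    rw [uIcc_of_le hT.le]
    simp only [← integral_Ioo_eq_intervalIntegral zero_le_one]
    exact continuousOn_wave_integral (isWeight_waveWeight hlam hc hφ T) hanti hτc.measurable hf2
  · exact (continuous_waveFlux hφ hfc).intervalIntegrable _ _

theorem tendsto_integral_translate_mul {f : ℝ → ℝ} {g : ℕ → ℝ → ℝ} (hf : MemLp f 2 volume)
    (hgL : ∀ n, MemLp (g n) 2 volume)
    (hlim : Tendsto (fun n => eLpNorm (fun s => g n s - f s) 2 volume) atTop (𝓝 0)) (T a : ℝ)
    {b : ℝ → ℝ} (hb : Continuous b) :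
    Tendsto (fun n => ∫ t in Ioo (0 : ℝ) T, g n (t + a) * b t) atTop
      (𝓝 (∫ t in Ioo (0 : ℝ) T, f (t + a) * b t)) := by
  obtain ⟨B, hB⟩ := isCompact_Icc.exists_bound_of_continuousOn (hb.continuousOn (s := Icc 0 T))
  have hmp := measurePreserving_add_right (volume : Measure ℝ) a
  have hmem : ∀ {h : ℝ → ℝ}, MemLp h 2 volume →
      MemLp (fun t => h (t + a)) 2 (volume.restrict (Ioo 0 T)) := fun hh =>
    (hh.comp_measurePreserving hmp).restrict _
  refine tendsto_integral_mul (C := B) (hmem hf) (fun n => hmem (hgL n)) ?_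
    (fun n => hb.aestronglyMeasurable) (Eventually.of_forall fun n =>
      (ae_restrict_iff' measurableSet_Ioo).2 (Eventually.of_forall fun t ht =>
        hB t (Ioo_subset_Icc_self ht))) (Eventually.of_forall fun x => tendsto_const_nhds)
  refine tendsto_of_tendsto_of_tendsto_of_le_of_le tendsto_const_nhds hlim
    (fun n => zero_le) fun n => ?_
  refine (eLpNorm_mono_measure _ Measure.restrict_le_self).trans (le_of_eq ?_)
  have h1 : AEStronglyMeasurable (fun s => g n s - f s) volume :=
    ((hgL n).sub hf).aestronglyMeasurable
  have h2 := eLpNorm_comp_measurePreserving (p := 2) h1 hmp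
  rw [Function.comp_def] at h2
  exact h2

theorem integrableOn_translate_mul {h : ℝ → ℝ} (hh : MemLp h 2 volume) (T a : ℝ)
    {b : ℝ → ℝ} (hb : Continuous b) : IntegrableOn (fun t => h (t + a) * b t) (Ioo 0 T) := by
  obtain ⟨B, hB⟩ := isCompact_Icc.exists_bound_of_continuousOn (hb.continuousOn (s := Icc 0 T))
  have hmem : MemLp (fun t => h (t + a)) 2 (volume.restrict (Ioo 0 T)) :=
    (hh.comp_measurePreserving (measurePreserving_add_right volume a)).restrict _
  exact (memLp_one_iff_integrable.1 (hmem.mono_exponent (by norm_num))).mul_bdd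
    hb.aestronglyMeasurable ((ae_restrict_iff' measurableSet_Ioo).2
      (Eventually.of_forall fun t ht => hB t (Ioo_subset_Icc_self ht)))

/-- The balance law of a square integrable wave tested against a `C¹` function. -/
theorem wave_identity (hlam : LipschitzWith Kl lam) (hc : LipschitzWith Kc c)
    (hne : ∀ x, lam x ≠ 0) (hτ : ∀ x, HasDerivAt τ (1 / lam x) x) (hanti : AntilipschitzWith 1 τ)
    (hφ : ContDiff ℝ 1 fun z : ℝ × ℝ => φ z.1 z.2) {f : ℝ → ℝ}
    (hf : MemLp f 2 volume) {T : ℝ} (hT : 0 < T) :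
    (∫ x in Ioo (0 : ℝ) 1, f (T + τ x) * (c x * φ T x)) -
        (∫ x in Ioo (0 : ℝ) 1, f (0 + τ x) * (c x * φ 0 x)) =
      (∫ t in Ioo (0 : ℝ) T, ∫ x in Ioo (0 : ℝ) 1, f (t + τ x) * waveWeight lam c φ t x) +
        ∫ t in Ioo (0 : ℝ) T, waveFlux lam c τ f φ t := by
  have hτc : Continuous τ := continuous_iff_continuousAt.2 fun x => (hτ x).continuousAt
  have hm := hτc.measurable
  have hw := isWeight_waveWeight hlam hc hφ T
  -- Smooth compactly supported profiles at distance at most `1/(n+1) ≤ 1` from `f`. The bound by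
  -- `1` yields the dominating constant for the time integral.
  choose g hgs hgc hgd using fun n : ℕ => hf.exist_eLpNorm_sub_le (by norm_num) (by norm_num)
    (show (0 : ℝ) < 1 / ((n : ℝ) + 1) by positivity)
  have hgL : ∀ n, MemLp (g n) 2 volume := fun n =>
    (hgc n).continuous.memLp_of_hasCompactSupport (hgs n)
  have hg1 : ∀ n, ContDiff ℝ 1 (g n) := fun n => (hgc n).of_le (by exact_mod_cast le_top)
  have hlim : Tendsto (fun n => eLpNorm (fun s => g n s - f s) 2 volume) atTop (𝓝 0) := by
    have h1 : Tendsto (fun n : ℕ => ENNReal.ofReal (1 / ((n : ℝ) + 1))) atTop (𝓝 0) := by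
      simpa using ENNReal.tendsto_ofReal tendsto_one_div_add_atTop_nhds_zero_nat
    refine tendsto_of_tendsto_of_tendsto_of_le_of_le tendsto_const_nhds h1
      (fun n => zero_le) fun n => ?_
    have := hgd n
    rw [eLpNorm_sub_comm] at this
    exact this
  have hlimw : ∀ t, Tendsto (fun n => eLpNorm (fun x => g n (t + τ x) - f (t + τ x)) 2 mu01)
      atTop (𝓝 0) := fun t =>
    tendsto_of_tendsto_of_tendsto_of_le_of_le tendsto_const_nhds hlim (fun n => zero_le) fun n =>
      eLpNorm_wave_le hanti hm ((hgL n).sub hf).aestronglyMeasurable t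
  have hpair : ∀ t ∈ Icc 0 T, ∀ w : ℝ → ℝ → ℝ, IsWeight T w →
      Tendsto (fun n => ∫ x in Ioo (0 : ℝ) 1, g n (t + τ x) * w t x) atTop
        (𝓝 (∫ x in Ioo (0 : ℝ) 1, f (t + τ x) * w t x)) := by
    intro t ht w ⟨a1, a2, W, a3⟩
    exact tendsto_integral_mul (C := W) (memLp_wave hanti hm hf t)
      (fun n => memLp_wave hanti hm (hgL n) t) (hlimw t)
      (fun n => (a1 t).aestronglyMeasurable)
      (Eventually.of_forall fun n => (ae_restrict_iff' measurableSet_Ioo).2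
        (Eventually.of_forall fun x hx => a3 t ht x hx))
      (Eventually.of_forall fun x => tendsto_const_nhds)
  have hcφ : IsWeight T fun t x => c x * φ t x :=
    .of_continuous ((hc.continuous.comp continuous_snd).mul hφ.continuous)
  have hL := (hpair T ⟨hT.le, le_rfl⟩ _ hcφ).sub (hpair 0 ⟨le_rfl, hT.le⟩ _ hcφ)
  have hD : Tendsto (fun n => ∫ t in Ioo (0 : ℝ) T, ∫ x in Ioo (0 : ℝ) 1,
      g n (t + τ x) * waveWeight lam c φ t x) atTop
      (𝓝 (∫ t in Ioo (0 : ℝ) T, ∫ x in Ioo (0 : ℝ) 1, f (t + τ x) * waveWeight lam c φ t x)) := by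
    obtain ⟨W, hW⟩ := hw.2.2
    refine tendsto_integral_of_dominated_convergence
      (fun _ => |W| * (eLpNorm f 2 volume + 1).toReal) (fun n => ?_)
      (integrable_const _) (fun n => ?_) ?_
    · exact ((continuousOn_wave_integral hw hanti hm (hgL n)).mono
        Ioo_subset_Icc_self).aestronglyMeasurable measurableSet_Ioo
    · refine (ae_restrict_iff' measurableSet_Ioo).2 (Eventually.of_forall fun t ht => ?_)
      refine (abs_integral_mul_le (C := |W|) (memLp_wave hanti hm (hgL n) t)
        ((ae_restrict_iff' measurableSet_Ioo).2 (Eventually.of_forall fun x hx =>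
          (hW t (Ioo_subset_Icc_self ht) x hx).trans (le_abs_self W)))).trans ?_
      refine mul_le_mul_of_nonneg_left (ENNReal.toReal_mono ?_ ?_) (abs_nonneg _)
      · exact ENNReal.add_ne_top.2 ⟨hf.eLpNorm_ne_top, ENNReal.one_ne_top⟩
      · refine (eLpNorm_wave_le hanti hm (hgL n).aestronglyMeasurable t).trans ?_
        have h1 : g n = f - (f - g n) := by simp
        calc eLpNorm (g n) 2 volume = eLpNorm (f - (f - g n)) 2 volume := by rw [← h1]
          _ ≤ eLpNorm f 2 volume + eLpNorm (f - g n) 2 volume :=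
            eLpNorm_sub_le hf.aestronglyMeasurable (hf.sub (hgL n)).aestronglyMeasurable
              (by norm_num)
          _ ≤ _ := by
            refine add_le_add le_rfl ((hgd n).trans ?_)
            rw [ENNReal.ofReal_le_one]
            rw [div_le_one (by positivity)]
            linarith [(Nat.cast_nonneg n : (0 : ℝ) ≤ n)]
    · refine (ae_restrict_iff' measurableSet_Ioo).2 (Eventually.of_forall fun t ht => ?_)
      exact hpair t (Ioo_subset_Icc_self ht) _ hw
  have hφx : ∀ x k : ℝ, Continuous fun t => k * φ t x := fun x k =>
    (hφ.continuous.comp (by fun_prop : Continuous fun t : ℝ => (t, x))).const_mul k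
  have hflux : ∀ h : ℝ → ℝ, MemLp h 2 volume → ∫ t in Ioo (0 : ℝ) T, waveFlux lam c τ h φ t =
      (∫ t in Ioo (0 : ℝ) T, h (t + τ 1) * (c 1 * lam 1 * φ t 1)) -
        ∫ t in Ioo (0 : ℝ) T, h (t + τ 0) * (c 0 * lam 0 * φ t 0) := by
    intro h hh
    have i1 := integrableOn_translate_mul hh T (τ 1) (hφx 1 (c 1 * lam 1))
    have i0 := integrableOn_translate_mul hh T (τ 0) (hφx 0 (c 0 * lam 0))
    rw [← integral_sub i1 i0]
    simp only [waveFlux]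
  have hF : Tendsto (fun n => ∫ t in Ioo (0 : ℝ) T, waveFlux lam c τ (g n) φ t) atTop
      (𝓝 (∫ t in Ioo (0 : ℝ) T, waveFlux lam c τ f φ t)) := by
    rw [hflux f hf]
    simp_rw [fun n => hflux (g n) (hgL n)]
    exact (tendsto_integral_translate_mul hf hgL hlim T (τ 1) (hφx 1 (c 1 * lam 1))).sub (tendsto_integral_translate_mul hf hgL hlim T (τ 0) (hφx 0 (c 0 * lam 0)))
  refine tendsto_nhds_unique hL ((hD.add hF).congr fun n => ?_)
  exact (wave_identity_of_contDiff hlam hc hne hτ hanti hφ (hg1 n) (hgL n) hT).symm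

end Wave

/-! ### Waves as continuous curves in `L²(0,1)`. -/

/-- The data of a family of waves `c(x) f(t + τ(x))` transported with speed `lam`. -/
structure IsWave (lam c τ : ℝ → ℝ) : Prop where
  lip_speed : ∃ K : ℝ≥0, LipschitzWith K lam
  lip_amp : ∃ K : ℝ≥0, LipschitzWith K c
  ne_zero : ∀ x, lam x ≠ 0
  phase : ∀ x, HasDerivAt τ (1 / lam x) x
  anti : AntilipschitzWith 1 τ
  amp_le : ∀ x, |c x| ≤ 1

namespace IsWave

variable {lam c τ f : ℝ → ℝ}

theorem continuous_phase (h : IsWave lam c τ) : Continuous τ :=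
  continuous_iff_continuousAt.2 fun x => (h.phase x).continuousAt

theorem continuous_amp (h : IsWave lam c τ) : Continuous c := by
  obtain ⟨K, hK⟩ := h.lip_amp
  exact hK.continuous

theorem memLp (h : IsWave lam c τ) (hf : MemLp f 2 volume) (t : ℝ) :
    MemLp (fun x => c x * f (t + τ x)) 2 mu01 := by
  have h1 := memLp_wave h.anti h.continuous_phase.measurable hf t
  refine h1.of_le (h.continuous_amp.aestronglyMeasurable.mul h1.aestronglyMeasurable)
    (Eventually.of_forall fun x => ?_)
  rw [norm_mul]
  exact mul_le_of_le_one_left (norm_nonneg _) (h.amp_le x)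

/-- The wave as a curve in `L²(0,1)`. -/
noncomputable def toLp (h : IsWave lam c τ) (hf : MemLp f 2 volume) (t : ℝ) : L2Space :=
  (h.memLp hf t).toLp _

theorem coeFn_toLp (h : IsWave lam c τ) (hf : MemLp f 2 volume) (t : ℝ) :
    h.toLp hf t =ᵐ[mu01] fun x => c x * f (t + τ x) :=
  (h.memLp hf t).coeFn_toLp

theorem continuous_toLp (h : IsWave lam c τ) (hf : MemLp f 2 volume) :
    Continuous (h.toLp hf) := by
  refine continuous_iff_continuousAt.2 fun t₀ => ?_
  unfold ContinuousAt toLp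
  rw [Lp.tendsto_Lp_iff_tendsto_eLpNorm'']
  refine tendsto_of_tendsto_of_tendsto_of_le_of_le tendsto_const_nhds
    (tendsto_eLpNorm_wave h.anti h.continuous_phase.measurable hf t₀) (fun t => zero_le)
    fun t => eLpNorm_mono fun x => ?_
  simp only [Pi.sub_apply]
  rw [← mul_sub, norm_mul]
  exact mul_le_of_le_one_left (norm_nonneg _) (h.amp_le x)

theorem isWeight (h : IsWave lam c τ) {φ : ℝ → ℝ → ℝ}
    (hφ : ContDiff ℝ 1 fun z : ℝ × ℝ => φ z.1 z.2) (T : ℝ) :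
    IsWeight T (waveWeight lam c φ) := by
  obtain ⟨_, h1⟩ := h.lip_speed
  obtain ⟨_, h2⟩ := h.lip_amp
  exact isWeight_waveWeight h1 h2 hφ T

theorem isWeight_amp_mul (h : IsWave lam c τ) {φ : ℝ → ℝ → ℝ}
    (hφ : ContDiff ℝ 1 fun z : ℝ × ℝ => φ z.1 z.2) (T : ℝ) :
    IsWeight T (fun t x => c x * φ t x) :=
  .of_continuous ((h.continuous_amp.comp continuous_snd).mul hφ.continuous)

theorem integrable_mul (h : IsWave lam c τ) (hf : MemLp f 2 volume) {T t : ℝ} (ht : t ∈ Icc 0 T)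
    {w : ℝ → ℝ → ℝ} (hw : IsWeight T w) : Integrable (fun x => f (t + τ x) * w t x) mu01 :=
  hw.integrable_mul ht (memLp_wave h.anti h.continuous_phase.measurable hf t)

theorem integrableOn_integral (h : IsWave lam c τ) (hf : MemLp f 2 volume) {T : ℝ}
    {w : ℝ → ℝ → ℝ} (hw : IsWeight T w) :
    IntegrableOn (fun t => ∫ x in Ioo (0 : ℝ) 1, f (t + τ x) * w t x) (Ioo 0 T) :=
  ((continuousOn_wave_integral hw h.anti h.continuous_phase.measurable hf).integrableOn_compact
    isCompact_Icc).mono_set Ioo_subset_Icc_self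

theorem integrableOn_flux (hf : MemLp f 2 volume) {T : ℝ} {φ : ℝ → ℝ → ℝ}
    (hφ : ContDiff ℝ 1 fun z : ℝ × ℝ => φ z.1 z.2) :
    IntegrableOn (waveFlux lam c τ f φ) (Ioo 0 T) := by
  have hφx : ∀ x k : ℝ, Continuous fun t => k * φ t x := fun x k =>
    (hφ.continuous.comp (by fun_prop : Continuous fun t : ℝ => (t, x))).const_mul k
  exact (integrableOn_translate_mul hf T (τ 1) (hφx 1 (c 1 * lam 1))).sub
    (integrableOn_translate_mul hf T (τ 0) (hφx 0 (c 0 * lam 0)))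

theorem identity (h : IsWave lam c τ) (hf : MemLp f 2 volume) {φ : ℝ → ℝ → ℝ}
    (hφ : ContDiff ℝ 1 fun z : ℝ × ℝ => φ z.1 z.2) {T : ℝ} (hT : 0 < T) :
    (∫ x in Ioo (0 : ℝ) 1, f (T + τ x) * (c x * φ T x)) -
        (∫ x in Ioo (0 : ℝ) 1, f (0 + τ x) * (c x * φ 0 x)) =
      (∫ t in Ioo (0 : ℝ) T, ∫ x in Ioo (0 : ℝ) 1, f (t + τ x) * waveWeight lam c φ t x) +
        ∫ t in Ioo (0 : ℝ) T, waveFlux lam c τ f φ t := by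
  obtain ⟨_, h1⟩ := h.lip_speed
  obtain ⟨_, h2⟩ := h.lip_amp
  exact wave_identity h1 h2 h.ne_zero h.phase h.anti hφ hf hT

end IsWave

theorem integral_add_six {α : Type*} [MeasurableSpace α] {μ : Measure α}
    {f₁ f₂ f₃ f₄ f₅ f₆ : α → ℝ} (h₁ : Integrable f₁ μ) (h₂ : Integrable f₂ μ)
    (h₃ : Integrable f₃ μ) (h₄ : Integrable f₄ μ) (h₅ : Integrable f₅ μ) (h₆ : Integrable f₆ μ) :
    ∫ x, (f₁ x + f₂ x + f₃ x + f₄ x + f₅ x + f₆ x) ∂μ =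
      ∫ x, f₁ x ∂μ + ∫ x, f₂ x ∂μ + ∫ x, f₃ x ∂μ + ∫ x, f₄ x ∂μ + ∫ x, f₅ x ∂μ + ∫ x, f₆ x ∂μ := by
  have h12 : Integrable (fun x => f₁ x + f₂ x) μ := h₁.add h₂
  have h123 : Integrable (fun x => f₁ x + f₂ x + f₃ x) μ := h12.add h₃
  have h1234 : Integrable (fun x => f₁ x + f₂ x + f₃ x + f₄ x) μ := h123.add h₄
  have h12345 : Integrable (fun x => f₁ x + f₂ x + f₃ x + f₄ x + f₅ x) μ := h1234.add h₅
  rw [integral_add h12345 h₆, integral_add h1234 h₅, integral_add h123 h₄, integral_add h12 h₃,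
    integral_add h₁ h₂]

/-! ### Explicit solutions of the coupled system. -/

/-- Globally extended coefficients: `L` is the second speed, `σ` its travel time from `0`, and `θ`
the angle by which the internal coupling rotates the first two components. -/
structure Coefficients (L σ θ : ℝ → ℝ) : Prop where
  lip_speed : ∃ K : ℝ≥0, LipschitzWith K L
  neg_one_le : ∀ x, -1 ≤ L x
  neg : ∀ x, L x < 0
  left : ∀ x ≤ 1 / 2, L x = -1
  deriv_time : ∀ x, HasDerivAt σ (-(1 / L x)) x
  lip_time : ∃ K : ℝ≥0, LipschitzWith K σ
  time_left : ∀ x ≤ 1 / 2, σ x = x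
  time_one : σ 1 = 2
  lip_angle : ∃ K : ℝ≥0, LipschitzWith K θ
  angle_left : ∀ x ≤ 0, θ x = 0
  angle_right : ∀ x, 1 / 2 ≤ x → θ x = θ 1

/-- The function `τ - id` is nondecreasing. -/
theorem antilipschitz_of_one_le_deriv {τ d : ℝ → ℝ} (hτ : ∀ x, HasDerivAt τ (d x) x)
    (hd : ∀ x, 1 ≤ d x) : AntilipschitzWith 1 τ := by
  have hmono : Monotone fun x => τ x - x := by
    refine monotone_of_deriv_nonneg (fun x => ((hτ x).sub (hasDerivAt_id x)).differentiableAt)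
      fun x => ?_
    have := ((hτ x).sub (hasDerivAt_id x)).deriv
    rw [show (fun x => τ x - x) = τ - id from rfl, this]
    linarith [hd x]
  refine AntilipschitzWith.of_le_mul_dist fun x y => ?_
  rw [NNReal.coe_one, one_mul, Real.dist_eq, Real.dist_eq]
  rcases le_total x y with h | h
  · have h1 := hmono h
    simp only at h1
    rw [abs_of_nonpos (by linarith), abs_of_nonpos (by linarith)]
    linarith
  · have h1 := hmono h
    simp only at h1
    rw [abs_of_nonneg (by linarith), abs_of_nonneg (by linarith)]
    linarith

theorem antilipschitz_neg {K : ℝ≥0} {τ : ℝ → ℝ} (hτ : AntilipschitzWith K τ) :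
    AntilipschitzWith K fun x => -τ x :=
  AntilipschitzWith.of_le_mul_dist fun x y => by simpa using hτ.le_mul_dist x y

namespace Coefficients

variable {L σ θ : ℝ → ℝ}

theorem one_le_deriv_time (h : Coefficients L σ θ) (x : ℝ) : 1 ≤ -(1 / L x) := by
  rw [← div_neg, le_div_iff₀ (by linarith [h.neg x])]
  linarith [h.neg_one_le x]

theorem antilipschitz_time (h : Coefficients L σ θ) : AntilipschitzWith 1 σ :=
  antilipschitz_of_one_le_deriv h.deriv_time h.one_le_deriv_time

theorem lip_cos (h : Coefficients L σ θ) :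
    ∃ K : ℝ≥0, LipschitzWith K fun x => Real.cos (θ x) := by
  obtain ⟨K, hK⟩ := h.lip_angle
  exact ⟨_, Real.lipschitzWith_cos.comp hK⟩

theorem lip_sin (h : Coefficients L σ θ) :
    ∃ K : ℝ≥0, LipschitzWith K fun x => Real.sin (θ x) := by
  obtain ⟨K, hK⟩ := h.lip_angle
  exact ⟨_, Real.lipschitzWith_sin.comp hK⟩

theorem isWave_one {c : ℝ → ℝ} (hc : ∃ K : ℝ≥0, LipschitzWith K c) (hc1 : ∀ x, |c x| ≤ 1) :
    IsWave (fun _ => -1) c fun x => -x where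
  lip_speed := ⟨0, LipschitzWith.const _⟩
  lip_amp := hc
  ne_zero := fun x => by norm_num
  phase := fun x => by simpa using hasDerivAt_neg' x
  anti := antilipschitz_neg AntilipschitzWith.id
  amp_le := hc1

theorem isWave_two (h : Coefficients L σ θ) {c : ℝ → ℝ} (hc : ∃ K : ℝ≥0, LipschitzWith K c)
    (hc1 : ∀ x, |c x| ≤ 1) : IsWave L c fun x => -σ x where
  lip_speed := h.lip_speed
  lip_amp := hc
  ne_zero := fun x => (h.neg x).ne
  phase := fun x => by simpa using (h.deriv_time x).fun_neg
  anti := antilipschitz_neg h.antilipschitz_time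
  amp_le := hc1

theorem isWave_three : IsWave (fun _ => 1 / 2) (fun _ => 1) fun x => 2 * x where
  lip_speed := ⟨0, LipschitzWith.const _⟩
  lip_amp := ⟨0, LipschitzWith.const _⟩
  ne_zero := fun x => by norm_num
  phase := fun x => by simpa using (hasDerivAt_id x).const_mul 2
  anti := antilipschitz_of_one_le_deriv (d := fun _ => 2)
    (fun x => by simpa using (hasDerivAt_id x).const_mul 2) fun x => by norm_num
  amp_le := fun x => by simp

theorem isWave_four : IsWave (fun _ => 1) (fun _ => 1) fun x => x where
  lip_speed := ⟨0, LipschitzWith.const _⟩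
  lip_amp := ⟨0, LipschitzWith.const _⟩
  ne_zero := fun x => by norm_num
  phase := fun x => by simpa using hasDerivAt_id' x
  anti := AntilipschitzWith.id
  amp_le := fun x => by simp

theorem isWave_cos_one (h : Coefficients L σ θ) :
    IsWave (fun _ => -1) (fun x => Real.cos (θ x)) fun x => -x :=
  isWave_one h.lip_cos fun _ => Real.abs_cos_le_one _

theorem isWave_sin_one (h : Coefficients L σ θ) :
    IsWave (fun _ => -1) (fun x => Real.sin (θ x)) fun x => -x :=
  isWave_one h.lip_sin fun _ => Real.abs_sin_le_one _

theorem isWave_cos_two (h : Coefficients L σ θ) :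
    IsWave L (fun x => Real.cos (θ x)) fun x => -σ x :=
  h.isWave_two h.lip_cos fun _ => Real.abs_cos_le_one _

theorem isWave_sin_two (h : Coefficients L σ θ) :
    IsWave L (fun x => -Real.sin (θ x)) fun x => -σ x :=
  h.isWave_two (by
    obtain ⟨K, hK⟩ := h.lip_sin
    exact ⟨K, hK.neg⟩) fun x => by rw [abs_neg]; exact Real.abs_sin_le_one _

/-- The solution generated by two profiles `G₁`, `G₂`. -/
noncomputable def solution (h : Coefficients L σ θ) {G₁ G₂ : ℝ → ℝ} (h₁ : MemLp G₁ 2 volume)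
    (h₂ : MemLp G₂ 2 volume) (t : ℝ) : State 2 2 :=
  Sum.elim
    ![h.isWave_cos_one.toLp h₁ t + h.isWave_sin_one.toLp h₂ t,
      h.isWave_sin_two.toLp h₁ t + h.isWave_cos_two.toLp h₂ t]
    ![isWave_three.toLp h₁ t, isWave_four.toLp h₂ t]

/-- The controls generating `solution`. -/
noncomputable def control {G₁ G₂ : ℝ → ℝ} (h₁ : MemLp G₁ 2 volume)
    (h₂ : MemLp G₂ 2 volume) : Control 2 :=
  ![(((h₁.comp_measurePreserving (measurePreserving_add_right volume 2)).restrict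
      (Ioi 0)).toLp (G₁ ∘ fun t => t + 2)),
    (((h₂.comp_measurePreserving (measurePreserving_add_right volume 1)).restrict
      (Ioi 0)).toLp (G₂ ∘ fun t => t + 1))]

variable {G₁ G₂ : ℝ → ℝ}

theorem coeFn_control_zero (h₁ : MemLp G₁ 2 volume) (h₂ : MemLp G₂ 2 volume) :
    control h₁ h₂ 0 =ᵐ[volume.restrict (Ioi 0)] fun t => G₁ (t + 2) :=
  ((h₁.comp_measurePreserving (measurePreserving_add_right volume 2)).restrict
    (Ioi 0)).coeFn_toLp

theorem coeFn_control_one (h₁ : MemLp G₁ 2 volume) (h₂ : MemLp G₂ 2 volume) :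
    control h₁ h₂ 1 =ᵐ[volume.restrict (Ioi 0)] fun t => G₂ (t + 1) :=
  ((h₂.comp_measurePreserving (measurePreserving_add_right volume 1)).restrict
    (Ioi 0)).coeFn_toLp

theorem coeFn_solution (h : Coefficients L σ θ) (h₁ : MemLp G₁ 2 volume)
    (h₂ : MemLp G₂ 2 volume) (t : ℝ) : ∀ᵐ x ∂mu01,
    h.solution h₁ h₂ t (Sum.inl 0) x =
        Real.cos (θ x) * G₁ (t + -x) + Real.sin (θ x) * G₂ (t + -x) ∧
      h.solution h₁ h₂ t (Sum.inl 1) x =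
        -Real.sin (θ x) * G₁ (t + -σ x) + Real.cos (θ x) * G₂ (t + -σ x) ∧
      h.solution h₁ h₂ t (Sum.inr 0) x = G₁ (t + 2 * x) ∧
      h.solution h₁ h₂ t (Sum.inr 1) x = G₂ (t + x) := by
  have e1 : h.solution h₁ h₂ t (Sum.inl 0) =
    h.isWave_cos_one.toLp h₁ t + h.isWave_sin_one.toLp h₂ t := rfl
  have e2 : h.solution h₁ h₂ t (Sum.inl 1) =
    h.isWave_sin_two.toLp h₁ t + h.isWave_cos_two.toLp h₂ t := rfl
  have e3 : h.solution h₁ h₂ t (Sum.inr 0) = isWave_three.toLp h₁ t := rfl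
  have e4 : h.solution h₁ h₂ t (Sum.inr 1) = isWave_four.toLp h₂ t := rfl
  rw [e1, e2, e3, e4]
  filter_upwards [Lp.coeFn_add (h.isWave_cos_one.toLp h₁ t) (h.isWave_sin_one.toLp h₂ t),
    Lp.coeFn_add (h.isWave_sin_two.toLp h₁ t) (h.isWave_cos_two.toLp h₂ t),
    h.isWave_cos_one.coeFn_toLp h₁ t, h.isWave_sin_one.coeFn_toLp h₂ t,
    h.isWave_sin_two.coeFn_toLp h₁ t, h.isWave_cos_two.coeFn_toLp h₂ t,
    isWave_three.coeFn_toLp h₁ t, isWave_four.coeFn_toLp h₂ t] with x a1 a2 b1 b2 b3 b4 b5 b6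
  rw [a1, a2, Pi.add_apply, Pi.add_apply, b1, b2, b3, b4, b5, b6]
  simp

theorem continuous_solution (h : Coefficients L σ θ) (h₁ : MemLp G₁ 2 volume)
    (h₂ : MemLp G₂ 2 volume) : Continuous (h.solution h₁ h₂) := by
  refine continuous_pi fun i => ?_
  rcases i with i | i <;> fin_cases i
  · exact (h.isWave_cos_one.continuous_toLp h₁).add (h.isWave_sin_one.continuous_toLp h₂)
  · exact (h.isWave_sin_two.continuous_toLp h₁).add (h.isWave_cos_two.continuous_toLp h₂)
  · exact isWave_three.continuous_toLp h₁
  · exact isWave_four.continuous_toLp h₂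

theorem ae_deriv_trig (h : Coefficients L σ θ) : ∀ᵐ x : ℝ,
    deriv (fun x => Real.cos (θ x)) x = -Real.sin (θ x) * deriv θ x ∧
    deriv (fun x => Real.sin (θ x)) x = Real.cos (θ x) * deriv θ x := by
  obtain ⟨K, hK⟩ := h.lip_angle
  filter_upwards [hK.ae_differentiableAt_real] with x hx
  exact ⟨hx.hasDerivAt.cos.deriv, hx.hasDerivAt.sin.deriv⟩

/-- The key cancellation: wherever the coupling acts, the two coupled components have the same speed
and the same phase, so it rotates them without mixing different times. -/
theorem deriv_angle_eq_zero_or (h : Coefficients L σ θ) (x : ℝ) :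
    deriv θ x = 0 ∨ (L x = -1 ∧ σ x = x) := by
  rcases le_or_gt x (1 / 2) with hx | hx
  · exact Or.inr ⟨h.left x hx, h.time_left x hx⟩
  · left
    have : θ =ᶠ[𝓝 x] fun _ => θ 1 := by
      filter_upwards [lt_mem_nhds hx] with y hy
      exact h.angle_right y hy.le
    rw [this.deriv_eq, deriv_const]

/-- Sum the balance laws of six waves, two in each of the first two components and one in each of
the others. The terms from differentiating the amplitudes are exactly the coupling terms, the fluxes
at `0` cancel by the boundary condition on `φ`, and the fluxes at `1` leave only the control term.
-/
theorem isWeakSolution (h : Coefficients L σ θ) (h₁ : MemLp G₁ 2 volume)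
    (h₂ : MemLp G₂ 2 volume) :
    IsWeakSolution (exampleSpeeds L) (exampleCoupling (deriv θ)) 1 (h.solution h₁ h₂ 0)
      (control h₁ h₂) (h.solution h₁ h₂) := by
  refine ⟨(h.continuous_solution h₁ h₂).continuousOn, fun T hT φ hφ => ?_⟩
  obtain ⟨hC, hφ1, hφ0⟩ := hφ
  have W1 := h.isWave_cos_one
  have W2 := h.isWave_sin_one
  have W3 := h.isWave_sin_two
  have W4 := h.isWave_cos_two
  have W5 := isWave_three
  have W6 := isWave_four
  have hE : ∀ t ∈ Icc 0 T, ∫ x in Ioo (0 : ℝ) 1, ∑ i, h.solution h₁ h₂ t i x * φ i t x =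
      (∫ x in Ioo (0 : ℝ) 1, G₁ (t + -x) * (Real.cos (θ x) * φ (Sum.inl 0) t x)) +
      (∫ x in Ioo (0 : ℝ) 1, G₂ (t + -x) * (Real.sin (θ x) * φ (Sum.inl 0) t x)) +
      (∫ x in Ioo (0 : ℝ) 1, G₁ (t + -σ x) * (-Real.sin (θ x) * φ (Sum.inl 1) t x)) +
      (∫ x in Ioo (0 : ℝ) 1, G₂ (t + -σ x) * (Real.cos (θ x) * φ (Sum.inl 1) t x)) +
      (∫ x in Ioo (0 : ℝ) 1, G₁ (t + 2 * x) * (1 * φ (Sum.inr 0) t x)) +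
      (∫ x in Ioo (0 : ℝ) 1, G₂ (t + x) * (1 * φ (Sum.inr 1) t x)) := by
    intro t ht
    rw [← integral_add_six (W1.integrable_mul h₁ ht (W1.isWeight_amp_mul (hC _) T))
      (W2.integrable_mul h₂ ht (W2.isWeight_amp_mul (hC _) T))
      (W3.integrable_mul h₁ ht (W3.isWeight_amp_mul (hC _) T))
      (W4.integrable_mul h₂ ht (W4.isWeight_amp_mul (hC _) T))
      (W5.integrable_mul h₁ ht (W5.isWeight_amp_mul (hC _) T))
      (W6.integrable_mul h₂ ht (W6.isWeight_amp_mul (hC _) T))]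
    refine integral_congr_ae ?_
    filter_upwards [h.coeFn_solution h₁ h₂ t] with x ⟨e1, e2, e3, e4⟩
    simp only [Fintype.sum_sum_type, Fin.sum_univ_two, e1, e2, e3, e4]
    ring
  have hD : ∀ t ∈ Ioo 0 T, ∫ x in Ioo (0 : ℝ) 1, ∑ i, h.solution h₁ h₂ t i x *
      (deriv (fun s => φ i s x) t - exampleSpeeds L i x * deriv (fun ξ => φ i t ξ) x
        + (-(deriv (exampleSpeeds L i) x * φ i t x) +
          ∑ k, exampleCoupling (deriv θ) x k i * φ k t x)) =
      (∫ x in Ioo (0 : ℝ) 1, G₁ (t + -x) *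
        waveWeight (fun _ => -1) (fun x => Real.cos (θ x)) (φ (Sum.inl 0)) t x) +
      (∫ x in Ioo (0 : ℝ) 1, G₂ (t + -x) *
        waveWeight (fun _ => -1) (fun x => Real.sin (θ x)) (φ (Sum.inl 0)) t x) +
      (∫ x in Ioo (0 : ℝ) 1, G₁ (t + -σ x) *
        waveWeight L (fun x => -Real.sin (θ x)) (φ (Sum.inl 1)) t x) +
      (∫ x in Ioo (0 : ℝ) 1, G₂ (t + -σ x) *
        waveWeight L (fun x => Real.cos (θ x)) (φ (Sum.inl 1)) t x) +
      (∫ x in Ioo (0 : ℝ) 1, G₁ (t + 2 * x) *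
        waveWeight (fun _ => 1 / 2) (fun _ => 1) (φ (Sum.inr 0)) t x) +
      (∫ x in Ioo (0 : ℝ) 1, G₂ (t + x) *
        waveWeight (fun _ => 1) (fun _ => 1) (φ (Sum.inr 1)) t x) := by
    intro t ht
    have ht' := Ioo_subset_Icc_self ht
    rw [← integral_add_six (W1.integrable_mul h₁ ht' (W1.isWeight (hC _) T))
      (W2.integrable_mul h₂ ht' (W2.isWeight (hC _) T))
      (W3.integrable_mul h₁ ht' (W3.isWeight (hC _) T))
      (W4.integrable_mul h₂ ht' (W4.isWeight (hC _) T))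
      (W5.integrable_mul h₁ ht' (W5.isWeight (hC _) T))
      (W6.integrable_mul h₂ ht' (W6.isWeight (hC _) T))]
    refine integral_congr_ae ?_
    filter_upwards [h.coeFn_solution h₁ h₂ t, ae_restrict_of_ae h.ae_deriv_trig]
      with x ⟨e1, e2, e3, e4⟩ ⟨d1, d2⟩
    simp only [Fintype.sum_sum_type, Fin.sum_univ_two, e1, e2, e3, e4, waveWeight, d1, d2,
      exampleSpeeds, exampleCoupling, deriv.fun_neg]
    simp
    -- The coupling exchanges terms carried by `t - x` and by `t - σ x`; they match because the
    -- phases agree wherever `θ'` is nonzero.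
    rcases h.deriv_angle_eq_zero_or x with h0 | ⟨hL, hs⟩
    · rw [h0]; ring
    · rw [hL, hs]; ring
  have hU : ∫ t in Ioo (0 : ℝ) T, ∑ j : Fin 2, control h₁ h₂ j t *
      (exampleSpeeds L (Sum.inr j) 1 * φ (Sum.inr j) t 1) =
      (∫ t in Ioo (0 : ℝ) T, waveFlux (fun _ => -1) (fun x => Real.cos (θ x)) (fun x => -x) G₁
        (φ (Sum.inl 0)) t) +
      (∫ t in Ioo (0 : ℝ) T, waveFlux (fun _ => -1) (fun x => Real.sin (θ x)) (fun x => -x) G₂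
        (φ (Sum.inl 0)) t) +
      (∫ t in Ioo (0 : ℝ) T, waveFlux L (fun x => -Real.sin (θ x)) (fun x => -σ x) G₁
        (φ (Sum.inl 1)) t) +
      (∫ t in Ioo (0 : ℝ) T, waveFlux L (fun x => Real.cos (θ x)) (fun x => -σ x) G₂
        (φ (Sum.inl 1)) t) +
      (∫ t in Ioo (0 : ℝ) T, waveFlux (fun _ => 1 / 2) (fun _ => 1) (fun x => 2 * x) G₁
        (φ (Sum.inr 0)) t) +
      (∫ t in Ioo (0 : ℝ) T, waveFlux (fun _ => 1) (fun _ => 1) (fun x => x) G₂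
        (φ (Sum.inr 1)) t) := by
    rw [← integral_add_six (IsWave.integrableOn_flux h₁ (hC _)) (IsWave.integrableOn_flux h₂ (hC _))
      (IsWave.integrableOn_flux h₁ (hC _)) (IsWave.integrableOn_flux h₂ (hC _))
      (IsWave.integrableOn_flux h₁ (hC _)) (IsWave.integrableOn_flux h₂ (hC _))]
    have u1 : control h₁ h₂ 0 =ᵐ[volume.restrict (Ioo 0 T)] fun t => G₁ (t + 2) :=
      ae_restrict_of_ae_restrict_of_subset Ioo_subset_Ioi_self (coeFn_control_zero h₁ h₂)
    have u2 : control h₁ h₂ 1 =ᵐ[volume.restrict (Ioo 0 T)] fun t => G₂ (t + 1) :=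
      ae_restrict_of_ae_restrict_of_subset Ioo_subset_Ioi_self (coeFn_control_one h₁ h₂)
    refine integral_congr_ae ?_
    filter_upwards [u1, u2, ae_restrict_mem measurableSet_Ioo] with t v1 v2 ht
    have ht' := Ioo_subset_Icc_self ht
    have q0 := hφ0 t ht' 0
    have q1 := hφ0 t ht' 1
    have p0 := hφ1 t ht' 0
    have p1 := hφ1 t ht' 1
    have hs0 : σ 0 = 0 := h.time_left 0 (by norm_num)
    have hL0 : L 0 = -1 := h.left 0 (by norm_num)
    have ha0 : θ 0 = 0 := h.angle_left 0 le_rfl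
    simp [adjointBoundaryMatrix, exampleSpeeds, Matrix.one_apply] at q0 q1
    simp only [Fin.sum_univ_two, v1, v2, waveFlux, p0, p1, q0, q1, hs0, hL0, ha0, exampleSpeeds]
    simp
    ring
  rw [hE T ⟨hT.le, le_rfl⟩, hE 0 ⟨le_rfl, hT.le⟩, hU,
    setIntegral_congr_fun measurableSet_Ioo hD,
    integral_add_six (W1.integrableOn_integral h₁ (W1.isWeight (hC _) T))
      (W2.integrableOn_integral h₂ (W2.isWeight (hC _) T))
      (W3.integrableOn_integral h₁ (W3.isWeight (hC _) T))
      (W4.integrableOn_integral h₂ (W4.isWeight (hC _) T))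
      (W5.integrableOn_integral h₁ (W5.isWeight (hC _) T))
      (W6.integrableOn_integral h₂ (W6.isWeight (hC _) T))]
  have i1 := W1.identity h₁ (hC (Sum.inl 0)) hT
  have i2 := W2.identity h₂ (hC (Sum.inl 0)) hT
  have i3 := W3.identity h₁ (hC (Sum.inl 1)) hT
  have i4 := W4.identity h₂ (hC (Sum.inl 1)) hT
  have i5 := W5.identity h₁ (hC (Sum.inr 0)) hT
  have i6 := W6.identity h₂ (hC (Sum.inr 1)) hT
  linarith

end Coefficients

/-! ### Generating states by profiles, and controllability above the threshold. -/

theorem State.ext_ae {z w : State 2 2} (h : ∀ᵐ x ∂mu01,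
    z (Sum.inl 0) x = w (Sum.inl 0) x ∧ z (Sum.inl 1) x = w (Sum.inl 1) x ∧
      z (Sum.inr 0) x = w (Sum.inr 0) x ∧ z (Sum.inr 1) x = w (Sum.inr 1) x) : z = w := by
  funext i
  apply Lp.ext
  rcases i with i | i <;> fin_cases i
  · exact h.mono fun x hx => hx.1
  · exact h.mono fun x hx => hx.2.1
  · exact h.mono fun x hx => hx.2.2.1
  · exact h.mono fun x hx => hx.2.2.2

/-- Every state is generated at time `0` by profiles supported in `[-A₁, 2]` and `[-A₂, 1]`. -/
def Generates (σ θ : ℝ → ℝ) (A₁ A₂ : ℝ) : Prop :=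
  ∀ z : State 2 2, ∃ f₁ f₂ : ℝ → ℝ, MemLp f₁ 2 volume ∧ MemLp f₂ 2 volume ∧
    (∀ s, s ≤ -A₁ ∨ 2 ≤ s → f₁ s = 0) ∧ (∀ s, s ≤ -A₂ ∨ 1 ≤ s → f₂ s = 0) ∧
    ∀ᵐ x ∂mu01,
      z (Sum.inl 0) x = Real.cos (θ x) * f₁ (-x) + Real.sin (θ x) * f₂ (-x) ∧
      z (Sum.inl 1) x = -Real.sin (θ x) * f₁ (-σ x) + Real.cos (θ x) * f₂ (-σ x) ∧
      z (Sum.inr 0) x = f₁ (2 * x) ∧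
      z (Sum.inr 1) x = f₂ x

/-- A state component, extended by zero to the real line. -/
noncomputable def zeroExtend (z : L2Space) : ℝ → ℝ := (Ioo (0 : ℝ) 1).indicator z

theorem memLp_zeroExtend (z : L2Space) : MemLp (zeroExtend z) 2 volume :=
  (memLp_indicator_iff_restrict measurableSet_Ioo).2 (Lp.memLp z)

theorem zeroExtend_of_mem (z : L2Space) {x : ℝ} (hx : x ∈ Ioo (0 : ℝ) 1) :
    zeroExtend z x = z x := indicator_of_mem hx _

theorem zeroExtend_of_notMem (z : L2Space) {x : ℝ} (hx : x ∉ Ioo (0 : ℝ) 1) :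
    zeroExtend z x = 0 := indicator_of_notMem hx _

theorem memLp_mul_of_abs_le_one {b f : ℝ → ℝ} (hb : Continuous b) (hb1 : ∀ x, |b x| ≤ 1)
    (hf : MemLp f 2 volume) : MemLp (fun x => b x * f x) 2 volume := by
  refine hf.of_le (hb.aestronglyMeasurable.mul hf.aestronglyMeasurable)
    (Eventually.of_forall fun x => ?_)
  rw [norm_mul]
  exact mul_le_of_le_one_left (norm_nonneg _) (hb1 x)

theorem memLp_comp_neg {f : ℝ → ℝ} (hf : MemLp f 2 volume) : MemLp (fun s => f (-s)) 2 volume :=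
  hf.comp_measurePreserving (Measure.measurePreserving_neg volume)

theorem memLp_comp_half {f : ℝ → ℝ} (hf : MemLp f 2 volume) :
    MemLp (fun s => f (s / 2)) 2 volume := by
  refine memLp_comp_of_antilipschitz (K := 2) ?_ (by fun_prop) hf
  refine AntilipschitzWith.of_le_mul_dist fun x y => ?_
  rw [Real.dist_eq, Real.dist_eq, ← sub_div, abs_div]
  simp
  linarith

namespace Coefficients

variable {L σ θ : ℝ → ℝ}

theorem strictMono_time (h : Coefficients L σ θ) : StrictMono σ :=
  strictMono_of_deriv_pos fun x => by
    rw [(h.deriv_time x).deriv]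
    linarith [h.one_le_deriv_time x]

theorem time_mem (h : Coefficients L σ θ) {x : ℝ} (hx : x ∈ Ioo (0 : ℝ) 1) :
    σ x ∈ Ioo (0 : ℝ) 2 := by
  have h0 := h.strictMono_time hx.1
  have h1 := h.strictMono_time hx.2
  rw [h.time_left 0 (by norm_num)] at h0
  rw [h.time_one] at h1
  exact ⟨h0, h1⟩

/-- Surjectivity holds because `σ - id` is nondecreasing and `σ 0 = 0`. The Lipschitz bound on `σ`
makes the inverse antilipschitz, so composition with it preserves `L²`. -/
theorem exists_inverse (h : Coefficients L σ θ) : ∃ ρ : ℝ → ℝ, (∀ x, ρ (σ x) = x) ∧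
    (∀ s, σ (ρ s) = s) ∧ ∀ f : ℝ → ℝ, MemLp f 2 volume → MemLp (fun s => f (ρ s)) 2 volume := by
  have hc : Continuous σ := continuous_iff_continuousAt.2 fun x => (h.deriv_time x).continuousAt
  have hmono : Monotone fun x => σ x - x := by
    refine monotone_of_deriv_nonneg
      (fun x => ((h.deriv_time x).sub (hasDerivAt_id x)).differentiableAt) fun x => ?_
    have := ((h.deriv_time x).sub (hasDerivAt_id x)).deriv
    rw [show (fun x => σ x - x) = σ - id from rfl, this]
    linarith [h.one_le_deriv_time x]
  have h0 : σ 0 = 0 := h.time_left 0 (by norm_num)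
  have hsurj : Function.Surjective σ := by
    refine hc.surjective (tendsto_atTop_mono' _ ?_ tendsto_id) (tendsto_atBot_mono' _ ?_ tendsto_id)
    · filter_upwards [eventually_ge_atTop 0] with x hx
      have := hmono hx
      simp only [h0, id] at this ⊢
      linarith
    · filter_upwards [eventually_le_atBot 0] with x hx
      have := hmono hx
      simp only [h0, id] at this ⊢
      linarith
  have hr : Function.RightInverse (Function.surjInv hsurj) σ := Function.rightInverse_surjInv hsurj
  have hl : Function.LeftInverse (Function.surjInv hsurj) σ :=
    Function.leftInverse_surjInv ⟨h.strictMono_time.injective, hsurj⟩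
  obtain ⟨K, hK⟩ := h.lip_time
  refine ⟨Function.surjInv hsurj, hl, hr, fun f hf => ?_⟩
  refine memLp_comp_of_antilipschitz (K := K) ?_
    (h.antilipschitz_time.to_rightInverse hr).continuous.measurable hf
  refine AntilipschitzWith.of_le_mul_dist fun x y => ?_
  have := hK.dist_le_mul (Function.surjInv hsurj x) (Function.surjInv hsurj y)
  rwa [hr x, hr y] at this

/-- On positive arguments the profiles are read off `y₃` and `y₄`; on negative ones they come from
applying the inverse rotation to `(y₁, y₂)`. The profile `f₁` is laid out along `σ` and `f₂` along
`x`. This is consistent: for `x ≤ 1/2` the phases coincide, and for `x > 1/2` one has `cos θ = 0`,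
so `y₁` sees only `f₂` and `y₂` only `f₁`. Hence the supports reach back to `-2` and `-1`. -/
theorem generates_of_sin_eq_one (h : Coefficients L σ θ) (h1 : Real.sin (θ 1) = 1) :
    Generates σ θ 2 1 := by
  intro z
  obtain ⟨ρ, hl, hr, hρ⟩ := h.exists_inverse
  obtain ⟨Kc, hKc⟩ := h.lip_cos
  obtain ⟨Ks, hKs⟩ := h.lip_sin
  have hz := fun i => memLp_zeroExtend (z i)
  have hcos := fun i => memLp_mul_of_abs_le_one hKc.continuous
    (fun x => Real.abs_cos_le_one (θ x)) (hz i)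
  have hsin := fun i => memLp_mul_of_abs_le_one hKs.continuous
    (fun x => Real.abs_sin_le_one (θ x)) (hz i)
  have hP : MemLp (fun x => Real.cos (θ x) * zeroExtend (z (Sum.inl 0)) x -
      Real.sin (θ x) * zeroExtend (z (Sum.inl 1)) x) 2 volume := (hcos _).sub (hsin _)
  have hN : MemLp (fun x => Real.sin (θ x) * zeroExtend (z (Sum.inl 0)) x +
      Real.cos (θ x) * zeroExtend (z (Sum.inl 1)) x) 2 volume := (hsin _).add (hcos _)
  have hmem : ∀ s, ρ (-s) ∈ Ioo (0 : ℝ) 1 → s ∈ Ioo (-2 : ℝ) 0 := by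
    intro s hs
    have := h.time_mem hs
    rw [hr] at this
    exact ⟨by linarith [this.2], by linarith [this.1]⟩
  refine ⟨_, _, (memLp_comp_half (hz (Sum.inr 0))).add (memLp_comp_neg (hρ _ hP)),
    (hz (Sum.inr 1)).add (memLp_comp_neg hN), fun s hs => ?_, fun s hs => ?_, ?_⟩
  · have n1 : s / 2 ∉ Ioo (0 : ℝ) 1 := by
      rintro ⟨_, _⟩
      rcases hs with hs | hs <;> linarith
    have n2 : ρ (-s) ∉ Ioo (0 : ℝ) 1 := by
      intro hm
      obtain ⟨_, _⟩ := hmem s hm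
      rcases hs with hs | hs <;> linarith
    simp [zeroExtend_of_notMem _ n1, zeroExtend_of_notMem _ n2]
  · have n1 : s ∉ Ioo (0 : ℝ) 1 := by
      rintro ⟨_, _⟩
      rcases hs with hs | hs <;> linarith
    have n2 : -s ∉ Ioo (0 : ℝ) 1 := by
      rintro ⟨_, _⟩
      rcases hs with hs | hs <;> linarith
    simp [zeroExtend_of_notMem _ n1, zeroExtend_of_notMem _ n2]
  · filter_upwards [ae_restrict_mem measurableSet_Ioo] with x hx
    have hsx := h.time_mem hx
    have m1 : -x / 2 ∉ Ioo (0 : ℝ) 1 := fun hm => by linarith [hm.1, hx.1]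
    have m2 : -σ x / 2 ∉ Ioo (0 : ℝ) 1 := fun hm => by linarith [hm.1, hsx.1]
    have m3 : -x ∉ Ioo (0 : ℝ) 1 := fun hm => by linarith [hm.1, hx.1]
    have m4 : -σ x ∉ Ioo (0 : ℝ) 1 := fun hm => by linarith [hm.1, hsx.1]
    have m5 : ρ (-(2 * x)) ∉ Ioo (0 : ℝ) 1 := fun hm => by linarith [(hmem _ hm).2, hx.1]
    have e1 : 2 * x / 2 = x := by ring
    have hsq := Real.sin_sq_add_cos_sq (θ x)
    simp only [Pi.add_apply, neg_neg, hl, zeroExtend_of_notMem _ m1, zeroExtend_of_notMem _ m2,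
      zeroExtend_of_notMem _ m3, zeroExtend_of_notMem _ m4, zeroExtend_of_notMem _ m5, e1,
      zeroExtend_of_mem _ hx]
    refine ⟨?_, ?_, by ring, by ring⟩
    · rcases le_or_gt x (1 / 2) with hx2 | hx2
      · have hρx : ρ x = x := by
          conv_lhs => rw [← h.time_left x hx2]
          exact hl x
        rw [hρx, zeroExtend_of_mem _ hx, zeroExtend_of_mem _ hx]
        linear_combination (-(z (Sum.inl 0) x)) * hsq
      · have hs1 : Real.sin (θ x) = 1 := by rw [h.angle_right x hx2.le, h1]
        have hc0 : Real.cos (θ x) = 0 := by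
          rw [hs1] at hsq
          nlinarith
        rw [hs1, hc0]
        ring
    · rcases le_or_gt x (1 / 2) with hx2 | hx2
      · rw [h.time_left x hx2, zeroExtend_of_mem _ hx, zeroExtend_of_mem _ hx]
        linear_combination (-(z (Sum.inl 1) x)) * hsq
      · have hs1 : Real.sin (θ x) = 1 := by rw [h.angle_right x hx2.le, h1]
        have hc0 : Real.cos (θ x) = 0 := by
          rw [hs1] at hsq
          nlinarith
        rw [hs1, hc0]
        ring

/-- Without rotation `y₁` is fed by `f₁` along `x` and `y₂` by `f₂` along `σ`, so the backward
supports are exchanged. -/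
theorem generates_of_angle_eq_zero (h : Coefficients L σ θ) (h0 : ∀ x, θ x = 0) :
    Generates σ θ 1 2 := by
  intro z
  obtain ⟨ρ, hl, hr, hρ⟩ := h.exists_inverse
  have hz := fun i => memLp_zeroExtend (z i)
  have hmem : ∀ s, ρ (-s) ∈ Ioo (0 : ℝ) 1 → s ∈ Ioo (-2 : ℝ) 0 := by
    intro s hs
    have := h.time_mem hs
    rw [hr] at this
    exact ⟨by linarith [this.2], by linarith [this.1]⟩
  refine ⟨_, _, (memLp_comp_half (hz (Sum.inr 0))).add (memLp_comp_neg (hz (Sum.inl 0))),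
    (hz (Sum.inr 1)).add (memLp_comp_neg (hρ _ (hz (Sum.inl 1)))), fun s hs => ?_,
    fun s hs => ?_, ?_⟩
  · have n1 : s / 2 ∉ Ioo (0 : ℝ) 1 := by
      rintro ⟨_, _⟩
      rcases hs with hs | hs <;> linarith
    have n2 : -s ∉ Ioo (0 : ℝ) 1 := by
      rintro ⟨_, _⟩
      rcases hs with hs | hs <;> linarith
    simp [zeroExtend_of_notMem _ n1, zeroExtend_of_notMem _ n2]
  · have n1 : s ∉ Ioo (0 : ℝ) 1 := by
      rintro ⟨_, _⟩
      rcases hs with hs | hs <;> linarith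
    have n2 : ρ (-s) ∉ Ioo (0 : ℝ) 1 := by
      intro hm
      obtain ⟨_, _⟩ := hmem s hm
      rcases hs with hs | hs <;> linarith
    simp [zeroExtend_of_notMem _ n1, zeroExtend_of_notMem _ n2]
  · filter_upwards [ae_restrict_mem measurableSet_Ioo] with x hx
    have hsx := h.time_mem hx
    have m1 : -x / 2 ∉ Ioo (0 : ℝ) 1 := fun hm => by linarith [hm.1, hx.1]
    have m3 : -(2 * x) ∉ Ioo (0 : ℝ) 1 := fun hm => by linarith [hm.1, hx.1]
    have m4 : -σ x ∉ Ioo (0 : ℝ) 1 := fun hm => by linarith [hm.1, hsx.1]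
    have m5 : ρ (-x) ∉ Ioo (0 : ℝ) 1 := fun hm => by linarith [(hmem _ hm).2, hx.1]
    have e1 : 2 * x / 2 = x := by ring
    simp only [Pi.add_apply, neg_neg, hl, zeroExtend_of_notMem _ m1, zeroExtend_of_notMem _ m3,
      zeroExtend_of_notMem _ m4, zeroExtend_of_notMem _ m5, e1, h0, Real.cos_zero,
      Real.sin_zero, zeroExtend_of_mem _ hx]
    refine ⟨by ring, by ring, by ring, by ring⟩

theorem exactlyControllable_of_generates (h : Coefficients L σ θ) {A₁ A₂ T : ℝ}
    (hg : Generates σ θ A₁ A₂) (h1 : A₁ + 2 ≤ T) (h2 : A₂ + 1 ≤ T) (h3 : 3 ≤ T)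
    (hsin : (∀ x, Real.sin (θ x) = 0) ∨ 4 ≤ T) :
    ExactlyControllable (exampleSpeeds L) (exampleCoupling (deriv θ)) 1 T := by
  intro y0 y1
  obtain ⟨f₁, f₂, hf1, hf2, s1, s2, e⟩ := hg y0
  obtain ⟨g₁, g₂, hg1, hg2, r1, r2, d⟩ := hg y1
  have hmp := measurePreserving_sub_right (volume : Measure ℝ) T
  -- Superpose the profiles of `y0` and those of `y1` delayed by `T`: each must be invisible at the
  -- time when the other is read.
  have hG1 : MemLp (fun s => f₁ s + g₁ (s - T)) 2 volume :=
    hf1.add (hg1.comp_measurePreserving hmp)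
  have hG2 : MemLp (fun s => f₂ s + g₂ (s - T)) 2 volume :=
    hf2.add (hg2.comp_measurePreserving hmp)
  have hy0 : h.solution hG1 hG2 0 = y0 := by
    refine State.ext_ae ?_
    filter_upwards [h.coeFn_solution hG1 hG2 0, e, ae_restrict_mem measurableSet_Ioo]
      with x ⟨a1, a2, a3, a4⟩ ⟨b1, b2, b3, b4⟩ hx
    have hsx := h.time_mem hx
    have hx0 := hx.1
    have hx1 := hx.2
    have hs0 := hsx.1
    rw [a1, a2, a3, a4, b1, b2, b3, b4]
    simp only [zero_add]
    rw [r1 (-x - T) (Or.inl (by linarith)), r2 (-x - T) (Or.inl (by linarith)),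
      r1 (-σ x - T) (Or.inl (by linarith)), r2 (-σ x - T) (Or.inl (by linarith)),
      r1 (2 * x - T) (Or.inl (by linarith)), r2 (x - T) (Or.inl (by linarith))]
    simp
  have hyT : h.solution hG1 hG2 T = y1 := by
    refine State.ext_ae ?_
    filter_upwards [h.coeFn_solution hG1 hG2 T, d, ae_restrict_mem measurableSet_Ioo]
      with x ⟨a1, a2, a3, a4⟩ ⟨b1, b2, b3, b4⟩ hx
    have hsx := h.time_mem hx
    have hx0 := hx.1
    have hx1 := hx.2
    have hs1 := hsx.2
    -- The only term that may require `T ≥ 4`: the slow signal of `y0` still present in the slow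
    -- component `y₂`, with `T - σ x > T - 2`.
    have hz : Real.sin (θ x) * f₁ (T + -σ x) = 0 := by
      rcases hsin with h0 | h4
      · rw [h0, zero_mul]
      · rw [s1 _ (Or.inr (by linarith)), mul_zero]
    have c1 : T + -x - T = -x := by ring
    have c2 : T + -σ x - T = -σ x := by ring
    have c3 : T + 2 * x - T = 2 * x := by ring
    have c4 : T + x - T = x := by ring
    rw [a1, a2, a3, a4, b1, b2, b3, b4, c1, c2, c3, c4]
    rw [s1 (T + -x) (Or.inr (by linarith)), s2 (T + -x) (Or.inr (by linarith)),
      s2 (T + -σ x) (Or.inr (by linarith)),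
      s1 (T + 2 * x) (Or.inr (by linarith)), s2 (T + x) (Or.inr (by linarith))]
    refine ⟨by ring, by linear_combination -hz, by ring, by ring⟩
  refine ⟨control hG1 hG2, h.solution hG1 hG2, ?_, hyT⟩
  have := h.isWeakSolution hG1 hG2
  rwa [hy0] at this

end Coefficients

/-! ### One-sided smoothing of Lipschitz amplitudes. -/

section Smoothing

theorem tendsto_backward_quotient {F : ℝ → ℝ} {F' x : ℝ} (hF : HasDerivAt F F' x) :
    Tendsto (fun n : ℕ => (F x - F (x - 1 / ((n : ℝ) + 2))) / (1 / ((n : ℝ) + 2))) atTop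
      (𝓝 F') := by
  have h1 : Tendsto (fun n : ℕ => x - 1 / ((n : ℝ) + 2)) atTop (𝓝[≠] x) := by
    refine tendsto_nhdsWithin_iff.2 ⟨?_, Eventually.of_forall fun n => ?_⟩
    · have h2 : Tendsto (fun n : ℕ => 1 / ((n : ℝ) + 2)) atTop (𝓝 0) := by
        refine tendsto_const_nhds.div_atTop ?_
        exact tendsto_atTop_add_const_right _ _ tendsto_natCast_atTop_atTop
      simpa using h2.const_sub x
    · have : (0 : ℝ) < 1 / ((n : ℝ) + 2) := by positivity
      simp only [mem_compl_iff, mem_singleton_iff]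
      linarith
  refine ((hasDerivAt_iff_tendsto_slope.1 hF).comp h1).congr fun n => ?_
  have : (n : ℝ) + 2 ≠ 0 := by positivity
  simp only [Function.comp_apply, slope_def_field]
  rw [← neg_sub (F x), sub_sub_cancel_left, neg_div_neg_eq]

/-- Bounded Lipschitz functions are limits of `C¹` functions with uniformly bounded derivatives
converging almost everywhere; the approximation only looks backwards. -/
theorem exists_contDiff_approx {p : ℝ → ℝ} {K : ℝ≥0} (hp : LipschitzWith K p) {B : ℝ}
    (hB : ∀ x, |p x| ≤ B) : ∃ P : ℕ → ℝ → ℝ, (∀ n, ContDiff ℝ 1 (P n)) ∧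
      (∀ n x, |P n x| ≤ B) ∧ (∀ n x, |deriv (P n) x| ≤ K) ∧
      (∀ x, Tendsto (fun n => P n x) atTop (𝓝 (p x))) ∧
      (∀ᵐ x : ℝ, Tendsto (fun n => deriv (P n) x) atTop (𝓝 (deriv p x))) ∧
      ∀ n x v, (∀ y ∈ Icc (x - 1 / 2) x, p y = v) → P n x = v := by
  have hpc := hp.continuous
  have hint : ∀ a b, IntervalIntegrable p volume a b := fun a b => hpc.intervalIntegrable a b
  set F : ℝ → ℝ := fun x => ∫ s in (0 : ℝ)..x, p s with hF
  have hFd : ∀ x, HasDerivAt F (p x) x := fun x =>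
    intervalIntegral.integral_hasDerivAt_right (hint 0 x)
      (hpc.stronglyMeasurableAtFilter _ _) hpc.continuousAt
  have hdiff : ∀ x y, F x - F y = ∫ s in y..x, p s := fun x y =>
    intervalIntegral.integral_interval_sub_left (hint 0 x) (hint 0 y)
  have hpos : ∀ n : ℕ, (0 : ℝ) < 1 / ((n : ℝ) + 2) := fun n => by positivity
  have hPd : ∀ (n : ℕ) x, HasDerivAt
      (fun x => (F x - F (x - 1 / ((n : ℝ) + 2))) / (1 / ((n : ℝ) + 2)))
      ((p x - p (x - 1 / ((n : ℝ) + 2))) / (1 / ((n : ℝ) + 2))) x := fun n x => by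
    have h1 := (hFd (x - 1 / ((n : ℝ) + 2))).comp x ((hasDerivAt_id x).sub_const _)
    rw [mul_one] at h1
    exact ((hFd x).sub h1).div_const _
  -- The mean of `p` over `[x - h, x]` with `h = 1/(n+2) ≤ 1/2`. Its derivative is the backward
  -- quotient of `p`, so the same limit of quotients gives the convergence of both the means and
  -- their derivatives.
  refine ⟨fun n x => (F x - F (x - 1 / ((n : ℝ) + 2))) / (1 / ((n : ℝ) + 2)),
    fun n => ?_, fun n x => ?_, fun n x => ?_, fun x => tendsto_backward_quotient (hFd x),
    ?_, fun n x v hv => ?_⟩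
  · rw [contDiff_one_iff_deriv]
    refine ⟨fun x => (hPd n x).differentiableAt, ?_⟩
    rw [funext fun x => (hPd n x).deriv]
    fun_prop
  · rw [abs_div, abs_of_pos (hpos n), div_le_iff₀ (hpos n), hdiff]
    have := intervalIntegral.norm_integral_le_of_norm_le_const
      (a := x - 1 / ((n : ℝ) + 2)) (b := x) (f := p) (C := B) fun s _ => hB s
    rw [sub_sub_cancel, abs_of_pos (hpos n)] at this
    exact this
  · rw [(hPd n x).deriv, abs_div, abs_of_pos (hpos n), div_le_iff₀ (hpos n)]
    have := hp.dist_le_mul x (x - 1 / ((n : ℝ) + 2))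
    rw [Real.dist_eq, Real.dist_eq, sub_sub_cancel, abs_of_pos (hpos n)] at this
    exact this
  · filter_upwards [hp.ae_differentiableAt_real] with x hx
    refine (tendsto_backward_quotient hx.hasDerivAt).congr fun n => ?_
    exact (hPd n x).deriv.symm
  · have hle : 1 / ((n : ℝ) + 2) ≤ 1 / 2 :=
      one_div_le_one_div_of_le (by norm_num) (by linarith [(Nat.cast_nonneg n : (0 : ℝ) ≤ n)])
    have : ∫ s in (x - 1 / ((n : ℝ) + 2))..x, p s = ∫ s in (x - 1 / ((n : ℝ) + 2))..x, v := by
      refine intervalIntegral.integral_congr fun s hs => ?_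
      rw [uIcc_of_le (by linarith [hpos n])] at hs
      exact hv s ⟨by linarith [hs.1], hs.2⟩
    simp only [hdiff]
    rw [this, intervalIntegral.integral_const, sub_sub_cancel, smul_eq_mul,
      mul_div_cancel_left₀ _ (hpos n).ne']

end Smoothing

/-! ### Adjoint states and the obstruction to controllability. -/

theorem tendsto_integral_coeFn_mul {Y : L2Space} {w : ℕ → ℝ → ℝ} {w₀ : ℝ → ℝ} {C : ℝ}
    (hw : ∀ n, Measurable (w n)) (hb : ∀ n, ∀ x ∈ Ioo (0 : ℝ) 1, |w n x| ≤ C)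
    (hlim : ∀ᵐ x ∂mu01, Tendsto (fun n => w n x) atTop (𝓝 (w₀ x))) :
    Tendsto (fun n => ∫ x in Ioo (0 : ℝ) 1, Y x * w n x) atTop
      (𝓝 (∫ x in Ioo (0 : ℝ) 1, Y x * w₀ x)) := by
  refine tendsto_integral_mul (C := C) (Lp.memLp Y) (fun _ => Lp.memLp Y) ?_
    (fun n => (hw n).aestronglyMeasurable) (Eventually.of_forall fun n =>
      (ae_restrict_iff' measurableSet_Ioo).2 (Eventually.of_forall fun x hx => hb n x hx)) hlim
  simp

theorem continuousOn_integral_coeFn_mul {Y : ℝ → L2Space} (hY : ContinuousOn Y (Ici 0)) {T : ℝ}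
    {w : ℝ → ℝ → ℝ} (hw : IsWeight T w) :
    ContinuousOn (fun t => ∫ x in Ioo (0 : ℝ) 1, Y t x * w t x) (Icc 0 T) := by
  refine hw.continuousOn_integral (fun t => Lp.memLp (Y t)) fun t₀ ht₀ => ?_
  have h1 := (hY t₀ ht₀.1).mono (Icc_subset_Ici_self : Icc 0 T ⊆ Ici 0)
  exact (Lp.tendsto_Lp_iff_tendsto_eLpNorm' _ _).1 h1

/-- Dominated convergence in `x` at each `t`, then in `t`, using that a continuous curve is bounded
in `L²` on `[0,T]`. It disposes of the residuals left by smoothing. -/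
theorem tendsto_integral_integral_coeFn_mul {Y : ℝ → L2Space} (hY : ContinuousOn Y (Ici 0))
    {T : ℝ} {w : ℕ → ℝ → ℝ → ℝ} (hw : ∀ n, IsWeight T (w n)) {C : ℝ}
    (hb : ∀ n t, ∀ x ∈ Ioo (0 : ℝ) 1, |w n t x| ≤ C)
    (hlim : ∀ t, ∀ᵐ x ∂mu01, Tendsto (fun n => w n t x) atTop (𝓝 0)) :
    Tendsto (fun n => ∫ t in Ioo (0 : ℝ) T, ∫ x in Ioo (0 : ℝ) 1, Y t x * w n t x) atTop
      (𝓝 0) := by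
  obtain ⟨B, hB⟩ := isCompact_Icc.exists_bound_of_continuousOn
    (hY.mono (Icc_subset_Ici_self : Icc 0 T ⊆ Ici 0))
  have hC : 0 ≤ C := (abs_nonneg _).trans (hb 0 0 (1 / 2) ⟨by norm_num, by norm_num⟩)
  suffices h0 : Tendsto (fun n => ∫ t in Ioo (0 : ℝ) T, ∫ x in Ioo (0 : ℝ) 1, Y t x * w n t x) atTop
      (𝓝 (∫ _ in Ioo (0 : ℝ) T, (0 : ℝ))) by simpa using h0
  refine tendsto_integral_of_dominated_convergence (fun _ => C * B) (fun n => ?_)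
    (integrable_const _) (fun n => ?_) ?_
  · exact ((continuousOn_integral_coeFn_mul hY (hw n)).mono
      Ioo_subset_Icc_self).aestronglyMeasurable measurableSet_Ioo
  · refine (ae_restrict_iff' measurableSet_Ioo).2 (Eventually.of_forall fun t ht => ?_)
    refine (abs_integral_mul_le (C := C) (Lp.memLp (Y t))
      ((ae_restrict_iff' measurableSet_Ioo).2 (Eventually.of_forall fun x hx =>
        hb n t x hx))).trans ?_
    exact mul_le_mul_of_nonneg_left (hB t (Ioo_subset_Icc_self ht)) hC
  · refine Eventually.of_forall fun t => ?_
    have := tendsto_integral_coeFn_mul (Y := Y t) (fun n => (hw n).1 t) (fun n => hb n t) (hlim t)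
    simpa using this

theorem integrable_coeFn_mul {Y : L2Space} {w : ℝ → ℝ} (hw : Measurable w) {C : ℝ}
    (hb : ∀ x ∈ Ioo (0 : ℝ) 1, |w x| ≤ C) : Integrable (fun x => Y x * w x) mu01 :=
  (memLp_one_iff_integrable.1 ((Lp.memLp Y).mono_exponent (by norm_num))).mul_bdd
    hw.aestronglyMeasurable
    ((ae_restrict_iff' measurableSet_Ioo).2 (Eventually.of_forall hb))

namespace Coefficients

variable {L σ θ : ℝ → ℝ}

theorem contDiff_time (h : Coefficients L σ θ) : ContDiff ℝ 1 σ := by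
  obtain ⟨K, hK⟩ := h.lip_speed
  rw [contDiff_one_iff_deriv]
  refine ⟨fun x => (h.deriv_time x).differentiableAt, ?_⟩
  rw [funext fun x => (h.deriv_time x).deriv]
  exact (continuous_const.div hK.continuous fun x => (h.neg x).ne).neg

/-- The amplitude `sin θ / L` of the second component of the adjoint state. -/
theorem exists_lip_quotient (h : Coefficients L σ θ) : ∃ (K : ℝ≥0) (B : ℝ),
    LipschitzWith K (fun x => Real.sin (θ x) / L x) ∧ ∀ x, |Real.sin (θ x) / L x| ≤ B := by
  obtain ⟨Ks, hKs⟩ := h.lip_sin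
  obtain ⟨Kl, hKl⟩ := h.lip_speed
  obtain ⟨Kt, hKt⟩ := h.lip_time
  -- The Lipschitz constant of the travel time bounds its derivative `-1/L`.
  have hinv : ∀ x, |(L x)⁻¹| ≤ Kt := fun x => by
    have := norm_deriv_le_of_lipschitz hKt (x₀ := x)
    rwa [(h.deriv_time x).deriv, norm_neg, one_div] at this
  refine ⟨Kt * Ks + Kt * Kt * Kl, Kt, LipschitzWith.of_dist_le_mul fun x y => ?_, fun x => ?_⟩
  · have h1 := hKs.dist_le_mul x y
    have h2 := hKl.dist_le_mul y x
    rw [Real.dist_eq, Real.dist_eq] at h1 h2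
    rw [abs_sub_comm y x] at h2
    have hx := (h.neg x).ne
    have hy := (h.neg y).ne
    have e : Real.sin (θ x) / L x - Real.sin (θ y) / L y =
        (L x)⁻¹ * (Real.sin (θ x) - Real.sin (θ y)) +
          (L x)⁻¹ * (L y)⁻¹ * Real.sin (θ y) * (L y - L x) := by
      field_simp
      ring
    rw [Real.dist_eq, Real.dist_eq, e]
    refine (abs_add_le _ _).trans ?_
    push_cast
    rw [add_mul]
    refine add_le_add ?_ ?_
    · rw [abs_mul, mul_assoc]
      exact mul_le_mul (hinv x) h1 (abs_nonneg _) Kt.coe_nonneg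
    · rw [abs_mul, abs_mul, abs_mul, mul_assoc _ (Kl : ℝ)]
      refine mul_le_mul ?_ h2 (abs_nonneg _) (by positivity)
      calc |(L x)⁻¹| * |(L y)⁻¹| * |Real.sin (θ y)| ≤ Kt * Kt * 1 :=
            mul_le_mul (mul_le_mul (hinv x) (hinv y) (abs_nonneg _) Kt.coe_nonneg)
              (Real.abs_sin_le_one _) (abs_nonneg _) (by positivity)
        _ = _ := mul_one _
  · rw [div_eq_mul_inv, abs_mul]
    calc _ ≤ 1 * (Kt : ℝ) := mul_le_mul (Real.abs_sin_le_one _) (hinv x) (abs_nonneg _) zero_le_one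
      _ = _ := one_mul _

/-- The adjoint state at time `T` issued from the boundary profile `g`. -/
noncomputable def adjointState (L σ θ g : ℝ → ℝ) (T : ℝ) : Fin 2 ⊕ Fin 2 → ℝ → ℝ :=
  Sum.elim ![fun x => Real.cos (θ x) * g (T - x), fun x => Real.sin (θ x) / L x * g (T - σ x)]
    ![fun x => 2 * g (T + 2 * x), fun _ => 0]

/-- The adjoint state solves the backward equation. The hypotheses on `g` give the boundary
condition at `x = 1` for the first two components and make the control term vanish, so the pairing
with a solution issued from `0` remains zero. As its amplitudes are only Lipschitz, smoothed
versions are tested and the residual tends to zero. -/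
theorem integral_adjointState_eq_zero (h : Coefficients L σ θ) {g : ℝ → ℝ} (hg : ContDiff ℝ 1 g)
    (hg1 : ∀ s, |g s| ≤ 1) {T : ℝ} (hT : 0 < T)
    (hb1 : ∀ t ∈ Icc 0 T, Real.cos (θ 1) * g (t - 1) = 0)
    (hb2 : ∀ t ∈ Icc 0 T, Real.sin (θ 1) = 0 ∨ g (t - 2) = 0)
    (hb3 : ∀ t ∈ Icc 0 T, g (t + 2) = 0) {u : Control 2} {y : ℝ → State 2 2}
    (hw : IsWeakSolution (exampleSpeeds L) (exampleCoupling (deriv θ)) 1 0 u y) :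
    ∫ x in Ioo (0 : ℝ) 1, ∑ i, y T i x * adjointState L σ θ g T i x = 0 := by
  obtain ⟨Kc, hKc⟩ := h.lip_cos
  obtain ⟨Kq, Bq, hKq, hBq⟩ := h.exists_lip_quotient
  obtain ⟨Ka, hKa⟩ := h.lip_angle
  obtain ⟨Kl, hKl⟩ := h.lip_speed
  obtain ⟨P, P1, P2, P3, P4, P5, P6⟩ := exists_contDiff_approx hKc fun x => Real.abs_cos_le_one _
  obtain ⟨Q, Q1, Q2, Q3, Q4, Q5, Q6⟩ := exists_contDiff_approx hKq hBq
  have hσ := h.contDiff_time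
  have hgc := hg.continuous
  have hσc := hσ.continuous
  have hPc := fun n => (P1 n).continuous
  have hQc := fun n => (Q1 n).continuous
  have ha : ∀ x, |deriv θ x| ≤ Ka := fun x => norm_deriv_le_of_lipschitz hKa
  have hl' : ∀ x, |deriv L x| ≤ Kl := fun x => norm_deriv_le_of_lipschitz hKl
  have hl : ∀ x, |L x| ≤ 1 := fun x => abs_le.2 ⟨h.neg_one_le x, by linarith [h.neg x]⟩
  have hBq0 : 0 ≤ Bq := (abs_nonneg _).trans (hBq 0)
  have hθ1 : ∀ x ∈ Icc ((1 : ℝ) - 1 / 2) 1, θ x = θ 1 := fun x hx =>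
    h.angle_right x (by linarith [hx.1])
  -- Smoothing keeps the boundary values exactly: the averages look backwards, and `θ` is constant
  -- on `(-∞, 0]` and on `[1/2, 1]`.
  have hP0 : ∀ n, P n 0 = 1 := fun n => P6 n 0 1 fun x hx => by
    rw [h.angle_left x hx.2, Real.cos_zero]
  have hP1 : ∀ n, P n 1 = Real.cos (θ 1) := fun n => P6 n 1 _ fun x hx => by rw [hθ1 x hx]
  have hQ0 : ∀ n, Q n 0 = 0 := fun n => Q6 n 0 0 fun x hx => by
    rw [h.angle_left x hx.2, Real.sin_zero, zero_div]
  -- The factor `2` is the entry `-(-1)/(1/2)` of `R`; the fourth component can be zero because `sin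
  -- θ` vanishes at `0`.
  set φ : ℕ → Fin 2 ⊕ Fin 2 → ℝ → ℝ → ℝ := fun n =>
    Sum.elim ![fun t x => P n x * g (t - x), fun t x => Q n x * g (t - σ x)]
      ![fun t x => 2 * g (t + 2 * x), fun _ _ => 0] with hφ
  have htest : ∀ n, IsTestFunction (exampleSpeeds L) 1 T (φ n) := by
    intro n
    refine ⟨fun i => ?_, fun t ht i => ?_, fun t ht j => ?_⟩
    · have c1 := P1 n
      have c2 := Q1 n
      rcases i with i | i <;> fin_cases i <;> simp [hφ] <;> fun_prop
    · fin_cases i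
      · simpa [hφ, hP1] using hb1 t ht
      · rcases hb2 t ht with h0 | h0
        · have : Q n 1 = 0 := Q6 n 1 0 fun x hx => by rw [hθ1 x hx, h0, zero_div]
          simp [hφ, this]
        · simp [hφ, h.time_one, h0]
    · fin_cases j <;>
        simp [hφ, adjointBoundaryMatrix, exampleSpeeds, Matrix.one_apply, hP0, hQ0]
  -- Residuals of the adjoint equation after smoothing. The derivatives of `g` cancel along the
  -- characteristics, so only bounded terms remain, and they tend to zero almost everywhere.
  set r₁ : ℕ → ℝ → ℝ → ℝ := fun n t x =>
    deriv (P n) x * g (t - x) - deriv θ x * Q n x * g (t - σ x) with hr₁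
  set r₂ : ℕ → ℝ → ℝ → ℝ := fun n t x =>
    deriv θ x * P n x * g (t - x) - (L x * deriv (Q n) x + deriv L x * Q n x) * g (t - σ x)
    with hr₂
  have wg1 : IsWeight T fun t x => g (t - x) := .of_continuous (by fun_prop)
  have wg2 : IsWeight T fun t x => g (t - σ x) := .of_continuous (by fun_prop)
  have wa : IsWeight T fun _ x => deriv θ x := .of_bounded (measurable_deriv θ) fun x _ => ha x
  have wl' : IsWeight T fun _ x => deriv L x := .of_bounded (measurable_deriv L) fun x _ => hl' x
  have wl : IsWeight T fun _ x => L x := .of_bounded hKl.continuous.measurable fun x _ => hl x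
  have wP : ∀ n, IsWeight T fun _ x => P n x := fun n =>
    .of_bounded (hPc n).measurable fun x _ => P2 n x
  have wQ : ∀ n, IsWeight T fun _ x => Q n x := fun n =>
    .of_bounded (hQc n).measurable fun x _ => Q2 n x
  have wP' : ∀ n, IsWeight T fun _ x => deriv (P n) x := fun n =>
    .of_bounded (measurable_deriv _) fun x _ => P3 n x
  have wQ' : ∀ n, IsWeight T fun _ x => deriv (Q n) x := fun n =>
    .of_bounded (measurable_deriv _) fun x _ => Q3 n x
  have w1 : ∀ n, IsWeight T (r₁ n) := fun n =>
    ((wP' n).mul wg1).sub ((wa.mul (wQ n)).mul wg2)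
  have w2 : ∀ n, IsWeight T (r₂ n) := fun n =>
    ((wa.mul (wP n)).mul wg1).sub (((wl.mul (wQ' n)).add (wl'.mul (wQ n))).mul wg2)
  have hyc : ∀ i, ContinuousOn (fun t => y t i) (Ici 0) := fun i =>
    (continuous_apply i).comp_continuousOn hw.1
  have hm : ∀ {a b A B : ℝ}, |a| ≤ A → |b| ≤ B → |a * b| ≤ A * B := fun {a b A B} h1 h2 => by
    rw [abs_mul]
    exact mul_le_mul h1 h2 (abs_nonneg _) ((abs_nonneg _).trans h1)
  have ht1 : Tendsto (fun n => ∫ t in Ioo (0 : ℝ) T, ∫ x in Ioo (0 : ℝ) 1,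
      y t (Sum.inl 0) x * r₁ n t x) atTop (𝓝 0) := by
    refine tendsto_integral_integral_coeFn_mul (hyc _) w1 (C := Kc * 1 + Ka * Bq * 1)
      (fun n t x hx => ?_) fun t => ?_
    · exact (abs_sub _ _).trans
        (add_le_add (hm (P3 n x) (hg1 _)) (hm (hm (ha x) (Q2 n x)) (hg1 _)))
    · filter_upwards [ae_restrict_of_ae P5, ae_restrict_of_ae h.ae_deriv_trig] with x hx hd
      have := (hx.mul_const (g (t - x))).sub
        (((Q4 x).const_mul (deriv θ x)).mul_const (g (t - σ x)))
      convert this using 2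
      rw [hd.1]
      rcases h.deriv_angle_eq_zero_or x with h0 | ⟨hL, hs⟩
      · rw [h0]; ring
      · rw [hL, hs]; ring
  have ht2 : Tendsto (fun n => ∫ t in Ioo (0 : ℝ) T, ∫ x in Ioo (0 : ℝ) 1,
      y t (Sum.inl 1) x * r₂ n t x) atTop (𝓝 0) := by
    refine tendsto_integral_integral_coeFn_mul (hyc _) w2
      (C := Ka * 1 * 1 + (1 * Kq + Kl * Bq) * 1) (fun n t x hx => ?_) fun t => ?_
    · refine (abs_sub _ _).trans (add_le_add (hm (hm (ha x) (P2 n x)) (hg1 _)) (hm ?_ (hg1 _)))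
      exact (abs_add_le _ _).trans (add_le_add (hm (hl x) (Q3 n x)) (hm (hl' x) (Q2 n x)))
    · filter_upwards [ae_restrict_of_ae Q5, ae_restrict_of_ae h.ae_deriv_trig,
        ae_restrict_of_ae hKl.ae_differentiableAt_real,
        ae_restrict_of_ae hKq.ae_differentiableAt_real] with x hx hd hL' hq'
      have := (((P4 x).const_mul (deriv θ x)).mul_const (g (t - x))).sub
        (((hx.const_mul (L x)).add ((Q4 x).const_mul (deriv L x))).mul_const (g (t - σ x)))
      convert this using 2
      have hprod : L x * deriv (fun x => Real.sin (θ x) / L x) x +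
          deriv L x * (Real.sin (θ x) / L x) = Real.cos (θ x) * deriv θ x := by
        have h1 := (hL'.hasDerivAt.mul hq'.hasDerivAt).deriv
        have h2 : (L * fun x => Real.sin (θ x) / L x) = fun x => Real.sin (θ x) :=
          funext fun x => mul_div_cancel₀ _ (h.neg x).ne
        rw [h2, hd.2] at h1
        rw [h1]
        ring
      rw [hprod]
      rcases h.deriv_angle_eq_zero_or x with h0 | ⟨hL, hs⟩
      · rw [h0]; ring
      · rw [hs]; ring
  have hmeas : ∀ n i, Continuous (φ n i T) := by
    intro n i
    have c1 := hPc n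
    have c2 := hQc n
    rcases i with i | i <;> fin_cases i <;> simp [hφ] <;> fun_prop
  have hbd : ∀ n i, ∀ x ∈ Ioo (0 : ℝ) 1, |φ n i T x| ≤ 2 + Bq := by
    intro n i x _
    rcases i with i | i <;> fin_cases i
    · exact (hm (P2 n x) (hg1 _)).trans (by linarith)
    · exact (hm (Q2 n x) (hg1 _)).trans (by linarith)
    · exact (hm (abs_two (α := ℝ)).le (hg1 _)).trans (by linarith)
    · exact (abs_zero (α := ℝ)).le.trans (by linarith)
  have hlimφ : ∀ i x, Tendsto (fun n => φ n i T x) atTop (𝓝 (adjointState L σ θ g T i x)) := by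
    intro i x
    rcases i with i | i <;> fin_cases i
    · exact (P4 x).mul_const _
    · exact (Q4 x).mul_const _
    · exact tendsto_const_nhds
    · exact tendsto_const_nhds
  have hleft : Tendsto (fun n => ∫ x in Ioo (0 : ℝ) 1, ∑ i, y T i x * φ n i T x) atTop
      (𝓝 (∫ x in Ioo (0 : ℝ) 1, ∑ i, y T i x * adjointState L σ θ g T i x)) := by
    have hcont : ∀ i, Measurable (adjointState L σ θ g T i) := fun i =>
      measurable_of_tendsto_metrizable (fun n => (hmeas n i).measurable)
        (tendsto_pi_nhds.2 fun x => hlimφ i x)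
    have hbd' : ∀ i, ∀ x ∈ Ioo (0 : ℝ) 1, |adjointState L σ θ g T i x| ≤ 2 + Bq := fun i x hx =>
      le_of_tendsto (hlimφ i x).abs (Eventually.of_forall fun n => hbd n i x hx)
    rw [integral_finsetSum _ fun i _ => integrable_coeFn_mul (hcont i) (hbd' i)]
    simp_rw [fun n => integral_finsetSum (μ := volume.restrict (Ioo (0 : ℝ) 1)) Finset.univ
      fun i _ => integrable_coeFn_mul (Y := y T i) (hmeas n i).measurable (hbd n i)]
    exact tendsto_finsetSum _ fun i _ => tendsto_integral_coeFn_mul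
      (fun n => (hmeas n i).measurable) (fun n => hbd n i) (Eventually.of_forall (hlimφ i))
  have hsum := ht1.add ht2
  rw [add_zero] at hsum
  refine tendsto_nhds_unique hleft (hsum.congr fun n => ?_)
  have key := hw.2 T hT (φ n) (htest n)
  have k0 : ∫ x in Ioo (0 : ℝ) 1, ∑ i, (0 : State 2 2) i x * φ n i 0 x = 0 := by
    refine integral_eq_zero_of_ae ?_
    filter_upwards [Lp.coeFn_zero ℝ 2 mu01] with x hx
    simp
  have k1 : ∫ t in Ioo (0 : ℝ) T, ∑ j : Fin 2, u j t *
      (exampleSpeeds L (Sum.inr j) 1 * φ n (Sum.inr j) t 1) = 0 := by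
    refine setIntegral_eq_zero_of_forall_eq_zero fun t ht => ?_
    simp [hφ, hb3 t (Ioo_subset_Icc_self ht)]
  rw [k0, k1, sub_zero, add_zero] at key
  rw [key, ← integral_add
    (((continuousOn_integral_coeFn_mul (hyc _) (w1 n)).integrableOn_compact
      isCompact_Icc).mono_set Ioo_subset_Icc_self)
    (((continuousOn_integral_coeFn_mul (hyc _) (w2 n)).integrableOn_compact
      isCompact_Icc).mono_set Ioo_subset_Icc_self)]
  refine setIntegral_congr_fun measurableSet_Ioo fun t ht => ?_
  have ht' := Ioo_subset_Icc_self ht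
  refine Eq.trans (integral_add ((w1 n).integrable_mul ht' (Lp.memLp (y t (Sum.inl 0))))
    ((w2 n).integrable_mul ht' (Lp.memLp (y t (Sum.inl 1))))).symm ?_
  refine integral_congr_ae (Eventually.of_forall fun x => ?_)
  have hgd : ∀ s, HasDerivAt g (deriv g s) s := fun s =>
    (hg.differentiable (by norm_num) s).hasDerivAt
  have hPd := ((P1 n).differentiable (by norm_num) x).hasDerivAt
  have hQd := ((Q1 n).differentiable (by norm_num) x).hasDerivAt
  have d1 : deriv (fun s => g (s - x)) t = deriv g (t - x) := by
    have := (hgd (t - x)).comp t ((hasDerivAt_id t).sub_const x)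
    rw [mul_one] at this
    exact this.deriv
  have d2 : deriv (fun ξ => P n ξ * g (t - ξ)) x =
      deriv (P n) x * g (t - x) - P n x * deriv g (t - x) := by
    have := hPd.mul ((hgd (t - x)).comp x ((hasDerivAt_id x).const_sub t))
    exact this.deriv.trans (by simp only [Function.comp_apply]; ring)
  have d3 : deriv (fun s => g (s - σ x)) t = deriv g (t - σ x) := by
    have := (hgd (t - σ x)).comp t ((hasDerivAt_id t).sub_const (σ x))
    rw [mul_one] at this
    exact this.deriv
  have d4 : deriv (fun ξ => Q n ξ * g (t - σ ξ)) x =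
      deriv (Q n) x * g (t - σ x) + Q n x * deriv g (t - σ x) * (1 / L x) := by
    have := hQd.mul ((hgd (t - σ x)).comp x ((h.deriv_time x).const_sub t))
    exact this.deriv.trans (by simp only [Function.comp_apply]; ring)
  have d5 : deriv (fun s => g (s + 2 * x)) t = deriv g (t + 2 * x) := by
    have := (hgd (t + 2 * x)).comp t ((hasDerivAt_id t).add_const (2 * x))
    rw [mul_one] at this
    exact this.deriv
  have d6 : deriv (fun ξ => g (t + 2 * ξ)) x = 2 * deriv g (t + 2 * x) := by
    have := (hgd (t + 2 * x)).comp x (((hasDerivAt_id x).const_mul 2).const_add t)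
    exact this.deriv.trans (by ring)
  have hLx := (h.neg x).ne
  simp only [Fintype.sum_sum_type, Fin.sum_univ_two, hφ, hr₁, hr₂, exampleSpeeds, exampleCoupling]
  simp
  rw [d1, d2, d3, d4, d5, d6]
  field_simp
  ring

/-- Take for `g` a bump centred at `c` with radius `r`, and as target the adjoint state itself.
Reaching it from `0` would make it orthogonal to itself, although it is nonzero at `x₀`, where the
bump sits at time `T`. -/
theorem not_exactlyControllable (h : Coefficients L σ θ) {T c r x₀ : ℝ} (hT : 0 < T) (hr : 0 < r)
    (hx₀ : x₀ ∈ Ioo (0 : ℝ) 1) (hb1 : Real.cos (θ 1) = 0 ∨ T - 1 ≤ c - r)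
    (hb2 : Real.sin (θ 1) = 0 ∨ T - 2 ≤ c - r) (hb3 : c + r ≤ 2)
    (hne : (Real.cos (θ x₀) ≠ 0 ∧ T - x₀ = c) ∨ (Real.sin (θ x₀) ≠ 0 ∧ T - σ x₀ = c)) :
    ¬ ExactlyControllable (exampleSpeeds L) (exampleCoupling (deriv θ)) 1 T := by
  intro hctrl
  let b : ContDiffBump c := ⟨r / 2, r, by positivity, by linarith⟩
  have hzero : ∀ s, s ≤ c - r ∨ c + r ≤ s → b s = 0 := by
    intro s hs
    refine b.zero_of_le_dist ?_
    change r ≤ dist s c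
    rw [Real.dist_eq]
    rcases hs with hs | hs
    · exact (by linarith : r ≤ -(s - c)).trans (neg_le_abs _)
    · exact (by linarith : r ≤ s - c).trans (le_abs_self _)
  have hbc : b c ≠ 0 := (b.pos_of_mem_ball (by
    rw [Metric.mem_ball, dist_self]; exact b.rOut_pos)).ne'
  have hb : ContDiff ℝ 1 b := b.contDiff
  have hbb : ∀ s, |b s| ≤ 1 := fun s => by
    rw [abs_of_nonneg b.nonneg]; exact b.le_one
  obtain ⟨Kq, Bq, hKq, hBq⟩ := h.exists_lip_quotient
  obtain ⟨Kc, hKc⟩ := h.lip_cos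
  have hbc' := hb.continuous
  have hσc := h.contDiff_time.continuous
  have hΨ : ∀ i, Continuous (adjointState L σ θ b T i) := by
    intro i
    rcases i with i | i <;> fin_cases i
    · exact hKc.continuous.mul (hbc'.comp (by fun_prop))
    · exact hKq.continuous.mul (hbc'.comp (by fun_prop))
    · exact continuous_const.mul (hbc'.comp (by fun_prop))
    · exact continuous_const
  have hΨL : ∀ i, MemLp (adjointState L σ θ b T i) 2 mu01 := fun i => by
    obtain ⟨C, hC⟩ := isCompact_Icc.exists_bound_of_continuousOn
      ((hΨ i).continuousOn (s := Icc (0 : ℝ) 1))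
    exact MemLp.of_bound (hΨ i).aestronglyMeasurable C
      ((ae_restrict_iff' measurableSet_Ioo).2 (Eventually.of_forall fun x hx =>
        hC x (Ioo_subset_Icc_self hx)))
  obtain ⟨u, y, hw, hy⟩ := hctrl 0 fun i => (hΨL i).toLp _
  have key := h.integral_adjointState_eq_zero hb hbb hT
    (fun t ht => by
      rcases hb1 with h0 | h0
      · rw [h0, zero_mul]
      · rw [hzero _ (Or.inl (by linarith [ht.2])), mul_zero])
    (fun t ht => hb2.imp id fun h0 => hzero _ (Or.inl (by linarith [ht.2])))
    (fun t ht => hzero _ (Or.inr (by linarith [ht.1]))) hw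
  have e : ∫ x in Ioo (0 : ℝ) 1, ∑ i, y T i x * adjointState L σ θ b T i x =
      ∫ x in Ioo (0 : ℝ) 1, ∑ i, adjointState L σ θ b T i x * adjointState L σ θ b T i x := by
    refine integral_congr_ae ?_
    have := ae_all_iff.2 fun i => (hΨL i).coeFn_toLp
    filter_upwards [this] with x hx
    rw [hy]
    exact Finset.sum_congr rfl fun i _ => by rw [hx i]
  rw [e] at key
  have hcont : Continuous fun x => ∑ i, adjointState L σ θ b T i x * adjointState L σ θ b T i x :=
    continuous_finsetSum _ fun i _ => (hΨ i).mul (hΨ i)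
  have hint : IntegrableOn (fun x => ∑ i, adjointState L σ θ b T i x *
      adjointState L σ θ b T i x) (Ioo 0 1) :=
    (hcont.continuousOn.integrableOn_compact isCompact_Icc).mono_set Ioo_subset_Icc_self
  -- A continuous nonnegative function with zero integral vanishes at every point of the open
  -- interval, in particular at `x₀`.
  have hae := (integral_eq_zero_iff_of_nonneg
    (fun x => Finset.sum_nonneg fun i _ => mul_self_nonneg _) hint).1 key
  have heq := Measure.eqOn_open_of_ae_eq hae isOpen_Ioo hcont.continuousOn
    continuousOn_const hx₀
  have hall : ∀ i, adjointState L σ θ b T i x₀ = 0 := fun i => by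
    have := (Finset.sum_eq_zero_iff_of_nonneg (fun i _ => mul_self_nonneg _)).1 heq i
      (Finset.mem_univ i)
    exact mul_self_eq_zero.1 this
  rcases hne with ⟨h1, h2⟩ | ⟨h1, h2⟩
  · have h3 := hall (Sum.inl 0)
    change Real.cos (θ x₀) * b (T - x₀) = 0 at h3
    rw [h2] at h3
    exact (mul_ne_zero h1 hbc) h3
  · have h3 := hall (Sum.inl 1)
    change Real.sin (θ x₀) / L x₀ * b (T - σ x₀) = 0 at h3
    rw [h2] at h3
    exact (mul_ne_zero (div_ne_zero h1 (h.neg x₀).ne) hbc) h3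

end Coefficients

/-! ### Independence of the extension of the data, and minimal times. -/

section Congruence

variable {p m : ℕ} {lam lam' : Fin p ⊕ Fin m → ℝ → ℝ}
  {M M' : ℝ → Matrix (Fin p ⊕ Fin m) (Fin p ⊕ Fin m) ℝ} {Q : Matrix (Fin p) (Fin m) ℝ}

/-- Weak solutions only see the speeds on `[0,1]` and the coupling almost everywhere. -/
theorem IsWeakSolution.congr (hlam : ∀ i, EqOn (lam i) (lam' i) (Icc 0 1))
    (hM : ∀ᵐ x ∂mu01, M x = M' x) {y0 : State p m} {u : Control m} {y : ℝ → State p m}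
    (h : IsWeakSolution lam M Q y0 u y) : IsWeakSolution lam' M' Q y0 u y := by
  refine ⟨h.1, fun T hT φ hφ => ?_⟩
  have hR : adjointBoundaryMatrix lam' Q = adjointBoundaryMatrix lam Q := by
    ext i j
    simp only [adjointBoundaryMatrix, Matrix.of_apply,
      hlam _ (left_mem_Icc.2 (zero_le_one : (0 : ℝ) ≤ 1))]
  have hφ' : IsTestFunction lam Q T φ := ⟨hφ.1, hφ.2.1, by rw [← hR]; exact hφ.2.2⟩
  have h1 := h.2 T hT φ hφ'
  rw [h1]
  congr 1
  · refine setIntegral_congr_fun measurableSet_Ioo fun t _ => ?_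
    refine integral_congr_ae ?_
    filter_upwards [hM, ae_restrict_mem measurableSet_Ioo] with x hx hx1
    refine Finset.sum_congr rfl fun i _ => ?_
    have hev : lam i =ᶠ[𝓝 x] lam' i :=
      eventually_of_mem (isOpen_Ioo.mem_nhds hx1) fun z hz => hlam i (Ioo_subset_Icc_self hz)
    rw [hx, hev.deriv_eq, hev.eq_of_nhds]
  · refine integral_congr_ae (Eventually.of_forall fun t => Finset.sum_congr rfl fun j _ => ?_)
    rw [hlam _ (right_mem_Icc.2 (zero_le_one : (0 : ℝ) ≤ 1))]

theorem exactlyControllable_congr (hlam : ∀ i, EqOn (lam i) (lam' i) (Icc 0 1))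
    (hM : ∀ᵐ x ∂mu01, M x = M' x) {T : ℝ} :
    ExactlyControllable lam M Q T ↔ ExactlyControllable lam' M' Q T := by
  constructor
  · intro h y0 y1
    obtain ⟨u, y, hy, hT⟩ := h y0 y1
    exact ⟨u, y, hy.congr hlam hM, hT⟩
  · intro h y0 y1
    obtain ⟨u, y, hy, hT⟩ := h y0 y1
    exact ⟨u, y, hy.congr (fun i => (hlam i).symm) (hM.mono fun x hx => hx.symm), hT⟩

theorem minimalTime_eq_of_iff {t₀ : ℝ} (h0 : 0 < t₀)
    (h : ∀ T, 0 < T → (ExactlyControllable lam M Q T ↔ t₀ ≤ T)) :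
    minimalTime lam M Q = ENNReal.ofReal t₀ := by
  refine le_antisymm (sInf_le ⟨t₀, ⟨h0, (h t₀ h0).2 le_rfl⟩, rfl⟩) (le_sInf ?_)
  rintro _ ⟨T, ⟨hT, hc⟩, rfl⟩
  exact ENNReal.ofReal_le_ofReal ((h T hT).1 hc)

end Congruence

/-! ### The two thresholds. -/

namespace Coefficients

variable {L σ θ : ℝ → ℝ}

theorem exactlyControllable_iff_of_angle_eq_pi_div_two (h : Coefficients L σ θ)
    (h1 : θ 1 = Real.pi / 2) {T : ℝ} (hT : 0 < T) :
    ExactlyControllable (exampleSpeeds L) (exampleCoupling (deriv θ)) 1 T ↔ 4 ≤ T := by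
  have hs : Real.sin (θ 1) = 1 := by rw [h1, Real.sin_pi_div_two]
  have hc : Real.cos (θ 1) = 0 := by rw [h1, Real.cos_pi_div_two]
  refine ⟨fun hctrl => ?_, fun h4 => h.exactlyControllable_of_generates
    (h.generates_of_sin_eq_one hs) (by linarith) (by linarith) (by linarith) (Or.inr h4)⟩
  by_contra! hT4
  -- As `cos θ(1) = 0`, the bump only has to live in `(T-2, 2)`. Its centre `T - σ x` lies there
  -- when `T - 2 < σ x < 2`, and `x > 1/2` ensures `sin θ(x) = 1`.
  have hev : ∀ᶠ x in 𝓝[<] (1 : ℝ), T - 2 < σ x ∧ x ∈ Ioo (1 / 2 : ℝ) 1 := by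
    refine Filter.Eventually.and ?_ (Ioo_mem_nhdsLT (by norm_num))
    refine nhdsWithin_le_nhds ((h.deriv_time 1).continuousAt.eventually_const_lt ?_)
    rw [h.time_one]
    linarith
  obtain ⟨x, hx1, hx2⟩ := hev.exists
  have hx : x ∈ Ioo (0 : ℝ) 1 := ⟨by linarith [hx2.1], hx2.2⟩
  have hσ := (h.time_mem hx).2
  refine h.not_exactlyControllable (c := T - σ x) (r := min (2 - σ x) (2 - (T - σ x))) hT
    (lt_min (by linarith) (by linarith)) hx (Or.inl hc) (Or.inr ?_) ?_ (Or.inr ⟨?_, rfl⟩) hctrl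
  · linarith [min_le_left (2 - σ x) (2 - (T - σ x))]
  · linarith [min_le_right (2 - σ x) (2 - (T - σ x))]
  · rw [h.angle_right x hx2.1.le, hs]
    exact one_ne_zero

theorem exactlyControllable_iff_of_angle_eq_zero (h : Coefficients L σ θ)
    (h0 : ∀ x, θ x = 0) {T : ℝ} (hT : 0 < T) :
    ExactlyControllable (exampleSpeeds L) (exampleCoupling (deriv θ)) 1 T ↔ 3 ≤ T := by
  have hs : ∀ x, Real.sin (θ x) = 0 := fun x => by rw [h0, Real.sin_zero]
  refine ⟨fun hctrl => ?_, fun h3 => h.exactlyControllable_of_generates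
    (h.generates_of_angle_eq_zero h0) (by linarith) (by linarith) h3 (Or.inl hs)⟩
  by_contra! hT3
  -- Here the window is `(T-1, 2)`, and the centre `T - x` lies in it when `T - 2 < x < 1`.
  obtain ⟨x, hx1, hx2⟩ := exists_between (max_lt one_pos (by linarith) : max 0 (T - 2) < 1)
  obtain ⟨hx0, hxT⟩ := max_lt_iff.1 hx1
  refine h.not_exactlyControllable (c := T - x) (r := min (1 - x) (2 - (T - x))) hT
    (lt_min (by linarith) (by linarith)) ⟨hx0, hx2⟩ (Or.inr ?_) (Or.inl (hs 1)) ?_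
    (Or.inl ⟨?_, rfl⟩) hctrl
  · linarith [min_le_left (1 - x) (2 - (T - x))]
  · linarith [min_le_right (1 - x) (2 - (T - x))]
  · rw [h0, Real.cos_zero]
    exact one_ne_zero

end Coefficients

/-! ### Extension of the given speed and coupling to the real line. -/

section Example

variable {lam2 a : ℝ → ℝ}

theorem integral_inv_speed (hlip : ∃ K : ℝ≥0, LipschitzOnWith K lam2 (Icc 0 1))
    (hbound : ∀ x ∈ Icc (0 : ℝ) 1, -1 ≤ lam2 x ∧ lam2 x < 0)
    (hleft : ∀ x ∈ Icc (0 : ℝ) (1 / 2), lam2 x = -1)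
    (htime : -(∫ ξ in (1 / 2 : ℝ)..1, 1 / lam2 ξ) = 3 / 2) :
    ∫ ξ in (0 : ℝ)..1, 1 / lam2 ξ = -2 := by
  obtain ⟨K, hK⟩ := hlip
  have hc : ContinuousOn (fun x => 1 / lam2 x) (Icc 0 1) :=
    continuousOn_const.div hK.continuousOn fun x hx => (hbound x hx).2.ne
  have h1 : ∫ ξ in (0 : ℝ)..(1 / 2), 1 / lam2 ξ = ∫ _ in (0 : ℝ)..(1 / 2), (-1 : ℝ) := by
    refine intervalIntegral.integral_congr fun x hx => ?_
    rw [uIcc_of_le (by norm_num)] at hx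
    simp only [hleft x hx]
    norm_num
  rw [← intervalIntegral.integral_add_adjacent_intervals (b := 1 / 2)
    (ContinuousOn.intervalIntegrable (hc.mono ?_)) (ContinuousOn.intervalIntegrable (hc.mono ?_)),
    h1, intervalIntegral.integral_const, smul_eq_mul]
  · linarith
  · rw [uIcc_of_le (by norm_num)]
    exact Icc_subset_Icc le_rfl (by norm_num)
  · rw [uIcc_of_le (by norm_num)]
    exact Icc_subset_Icc (by norm_num) le_rfl

/-- The speed extends to the real line together with its travel time. -/
theorem exists_extension (hlip : ∃ K : ℝ≥0, LipschitzOnWith K lam2 (Icc 0 1))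
    (hbound : ∀ x ∈ Icc (0 : ℝ) 1, -1 ≤ lam2 x ∧ lam2 x < 0)
    (hleft : ∀ x ∈ Icc (0 : ℝ) (1 / 2), lam2 x = -1)
    (htime : -(∫ ξ in (1 / 2 : ℝ)..1, 1 / lam2 ξ) = 3 / 2) :
    ∃ L σ : ℝ → ℝ, EqOn lam2 L (Icc 0 1) ∧ ∀ θ : ℝ → ℝ, (∃ K : ℝ≥0, LipschitzWith K θ) →
      (∀ x ≤ 0, θ x = 0) → (∀ x, 1 / 2 ≤ x → θ x = θ 1) → Coefficients L σ θ := by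
  have hint := integral_inv_speed hlip hbound hleft htime
  obtain ⟨K, hK⟩ := hlip
  -- Clamping to `[0,1]` preserves the Lipschitz constant and the bounds. `L` and its travel time do
  -- not depend on `θ`, so they serve both systems.
  set L : ℝ → ℝ := fun x => lam2 (max 0 (min x 1)) with hL
  have hmem : ∀ x : ℝ, max 0 (min x 1) ∈ Icc (0 : ℝ) 1 := fun x =>
    ⟨le_max_left _ _, max_le zero_le_one (min_le_right _ _)⟩
  have hLlip : LipschitzWith K L := by
    refine LipschitzWith.of_dist_le_mul fun x y => (hK.dist_le_mul _ (hmem x) _ (hmem y)).trans ?_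
    refine mul_le_mul_of_nonneg_left ?_ K.coe_nonneg
    have h1 : LipschitzWith 1 fun x : ℝ => max 0 (min x 1) :=
      (LipschitzWith.id.min_const 1).const_max 0
    simpa using h1.dist_le_mul x y
  have hLneg : ∀ x, L x < 0 := fun x => (hbound _ (hmem x)).2
  have heq : EqOn lam2 L (Icc 0 1) := fun x hx => by
    simp only [hL, min_eq_left hx.2, max_eq_right hx.1]
  have hLleft : ∀ x ≤ 1 / 2, L x = -1 := fun x hx =>
    hleft _ ⟨le_max_left _ _, max_le (by norm_num) ((min_le_left _ _).trans hx)⟩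
  have hinvc : Continuous fun x => -(1 / L x) :=
    (continuous_const.div hLlip.continuous fun x => (hLneg x).ne).neg
  have hσd : ∀ x, HasDerivAt (fun x => ∫ s in (0 : ℝ)..x, -(1 / L s)) (-(1 / L x)) x := fun x =>
    intervalIntegral.integral_hasDerivAt_right (hinvc.intervalIntegrable _ _)
      (hinvc.stronglyMeasurableAtFilter _ _) hinvc.continuousAt
  obtain ⟨C, hC⟩ := isCompact_Icc.exists_bound_of_continuousOn
    (hinvc.continuousOn (s := Icc (0 : ℝ) 1))
  have hCb : ∀ x, ‖-(1 / L x)‖ ≤ C := fun x => by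
    have := hC _ (hmem x)
    rwa [← heq (hmem x)] at this
  refine ⟨L, fun x => ∫ s in (0 : ℝ)..x, -(1 / L s), heq, fun θ h1 h2 h3 =>
    ⟨⟨K, hLlip⟩, fun x => (hbound _ (hmem x)).1, hLneg, hLleft, hσd, ⟨C.toNNReal, ?_⟩,
      fun x hx => ?_, ?_, h1, h2, h3⟩⟩
  · refine lipschitzWith_of_nnnorm_deriv_le (fun x => (hσd x).differentiableAt) fun x => ?_
    rw [(hσd x).deriv, ← NNReal.coe_le_coe, coe_nnnorm]
    exact (hCb x).trans (Real.le_coe_toNNReal C)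
  · have : ∫ s in (0 : ℝ)..x, -(1 / L s) = ∫ _ in (0 : ℝ)..x, (1 : ℝ) := by
      refine intervalIntegral.integral_congr fun s hs => ?_
      have hs2 : s ≤ 1 / 2 := hs.2.trans (max_le (by norm_num) hx)
      simp only [hLleft s hs2]
      norm_num
    rw [this]
    simp
  · have : ∫ s in (0 : ℝ)..1, -(1 / L s) = ∫ s in (0 : ℝ)..1, -(1 / lam2 s) := by
      refine intervalIntegral.integral_congr fun s hs => ?_
      rw [uIcc_of_le zero_le_one] at hs
      simp only [heq hs]
    rw [this, intervalIntegral.integral_neg, hint, neg_neg]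

/-- The total rotation angle of the coupling. -/
theorem exists_angle (ha : MemLp a ∞ (volume.restrict (Ioo (0 : ℝ) 1)))
    (ha_right : ∀ᵐ x ∂(volume.restrict (Ioo (1 / 2 : ℝ) 1)), a x = 0)
    (ha_int : ∫ x in (0 : ℝ)..(1 / 2), a x = Real.pi / 2) :
    ∃ θ : ℝ → ℝ, (∃ K : ℝ≥0, LipschitzWith K θ) ∧ (∀ x ≤ 0, θ x = 0) ∧
      (∀ x, 1 / 2 ≤ x → θ x = θ 1) ∧ θ 1 = Real.pi / 2 ∧ ∀ᵐ x ∂mu01, a x = deriv θ x := by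
  have hsub : Ioo (0 : ℝ) (1 / 2) ⊆ Ioo 0 1 := Ioo_subset_Ioo_right (by norm_num)
  -- Truncation makes the primitive constant outside `[0,1/2]`; on `(0,1)` it changes `a` only on a
  -- null set.
  set b : ℝ → ℝ := (Ioo (0 : ℝ) (1 / 2)).indicator a with hb
  have hbi : Integrable b := by
    refine (integrable_indicator_iff measurableSet_Ioo).2 ?_
    have h1 : IntegrableOn a (Ioo 0 1) := ha.integrable (by simp)
    exact h1.mono_set hsub
  have hII : ∀ x y, IntervalIntegrable b volume x y := fun x y => hbi.intervalIntegrable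
  obtain ⟨C, hC⟩ : ∃ C : ℝ, ∀ᵐ x ∂(volume.restrict (Ioo (0 : ℝ) 1)), ‖a x‖ ≤ C := by
    refine ⟨(eLpNorm a ∞ (volume.restrict (Ioo (0 : ℝ) 1))).toReal, ?_⟩
    filter_upwards [ae_le_eLpNormEssSup (f := a) (μ := volume.restrict (Ioo (0 : ℝ) 1))] with x hx
    rw [← toReal_enorm]
    exact ENNReal.toReal_mono ha.eLpNorm_ne_top (by rwa [eLpNorm_exponent_top])
  have hC' : ∀ᵐ x : ℝ, ‖b x‖ ≤ |C| := by
    filter_upwards [(ae_restrict_iff' measurableSet_Ioo).1 hC] with x hx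
    by_cases hm : x ∈ Ioo (0 : ℝ) (1 / 2)
    · rw [hb, indicator_of_mem hm]
      exact (hx (hsub hm)).trans (le_abs_self C)
    · rw [hb, indicator_of_notMem hm, norm_zero]
      exact abs_nonneg _
  have hdiff : ∀ x y, (∫ s in (0 : ℝ)..x, b s) - (∫ s in (0 : ℝ)..y, b s) = ∫ s in y..x, b s :=
    fun x y => intervalIntegral.integral_interval_sub_left (hII 0 x) (hII 0 y)
  have hright : ∀ x, 1 / 2 ≤ x → ∫ s in (0 : ℝ)..x, b s = Real.pi / 2 := by
    intro x hx
    rw [intervalIntegral.integral_of_le (by linarith), hb, setIntegral_indicator measurableSet_Ioo,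
      ← ha_int, intervalIntegral.integral_of_le (by norm_num), integral_Ioc_eq_integral_Ioo]
    congr 2
    ext s
    simp only [mem_inter_iff, mem_Ioc, mem_Ioo]
    constructor
    · exact fun h => h.2
    · exact fun h => ⟨⟨h.1, by linarith [h.2]⟩, h⟩
  refine ⟨fun x => ∫ s in (0 : ℝ)..x, b s, ⟨|C|.toNNReal, ?_⟩, fun x hx => ?_, fun x hx => ?_,
    hright 1 (by norm_num), ?_⟩
  · refine LipschitzWith.of_dist_le_mul fun x y => ?_
    rw [Real.dist_eq, hdiff, Real.dist_eq, Real.coe_toNNReal _ (abs_nonneg C)]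
    exact intervalIntegral.norm_integral_le_of_norm_le_const_ae (hC'.mono fun s hs _ => hs)
  · have : ∫ s in (0 : ℝ)..x, b s = ∫ _ in (0 : ℝ)..x, (0 : ℝ) := by
      refine intervalIntegral.integral_congr fun s hs => ?_
      rw [uIcc_of_ge hx] at hs
      exact indicator_of_notMem (fun hm => by linarith [hm.1, hs.2]) _
    simp only [this, intervalIntegral.integral_zero]
  · simp only
    rw [hright x hx, hright 1 (by norm_num)]
  · have h0 := (ae_restrict_iff' measurableSet_Ioo).1 ha_right
    -- Lebesgue differentiation recovers the coupling almost everywhere as the derivative of the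
    -- angle.
    filter_upwards [ae_restrict_of_ae (LocallyIntegrable.ae_hasDerivAt_integral
      hbi.locallyIntegrable),
      ae_restrict_of_ae h0, ae_restrict_of_ae (Measure.ae_ne volume (1 / 2 : ℝ)),
      ae_restrict_mem measurableSet_Ioo] with x h1 h2 h3 hx
    rw [(h1 0).deriv, hb]
    rcases lt_or_gt_of_ne h3 with h4 | h4
    · have hm : x ∈ Ioo (0 : ℝ) (1 / 2) := ⟨hx.1, h4⟩
      rw [indicator_of_mem hm]
    · rw [indicator_of_notMem fun hm => by linarith [hm.2], h2 ⟨h4, hx.2⟩]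

theorem orderedSpeeds_example (hbound : ∀ x ∈ Icc (0 : ℝ) 1, -1 ≤ lam2 x ∧ lam2 x < 0) :
    OrderedSpeeds (exampleSpeeds lam2) := by
  intro x hx
  obtain ⟨h1, h2⟩ := hbound x hx
  refine ⟨fun i i' hi => ?_, fun i => ?_, fun j => ?_, fun j j' hj => ?_⟩
  · fin_cases i <;> fin_cases i' <;> simp_all [exampleSpeeds]
  · fin_cases i <;> simp [exampleSpeeds, h2]
  · fin_cases j <;> simp [exampleSpeeds]
  · fin_cases j <;> fin_cases j' <;> simp_all [exampleSpeeds]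
    norm_num

/-- The first two speeds agree at `0`. Agreement on all of `[0,1]` would make the crossing time of
`[1/2,1]` equal to `1/2` instead of `3/2`. -/
theorem not_agreeSomewhereImpliesEverywhere_example
    (hleft : ∀ x ∈ Icc (0 : ℝ) (1 / 2), lam2 x = -1)
    (htime : -(∫ ξ in (1 / 2 : ℝ)..1, 1 / lam2 ξ) = 3 / 2) :
    ¬ AgreeSomewhereImpliesEverywhere (exampleSpeeds lam2) := by
  intro h
  have h1 : ∀ x ∈ Icc (0 : ℝ) 1, -1 = lam2 x :=
    h (Sum.inl 0) (Sum.inl 1) (by simp) ⟨0, by simp, (hleft 0 (by simp)).symm⟩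
  have h2 : ∫ ξ in (1 / 2 : ℝ)..1, 1 / lam2 ξ = ∫ _ in (1 / 2 : ℝ)..1, (-1 : ℝ) := by
    refine intervalIntegral.integral_congr fun x hx => ?_
    rw [uIcc_of_le (by norm_num)] at hx
    simp only [← h1 x ⟨by linarith [hx.1], hx.2⟩]
    norm_num
  rw [h2, intervalIntegral.integral_const, smul_eq_mul] at htime
  norm_num at htime

end Example

end HyperbolicControl

theorem mainTheorem6 (lam2 a : ℝ → ℝ)
    (hlip : ∃ K : ℝ≥0, LipschitzOnWith K lam2 (Icc 0 1))
    (hbound : ∀ x ∈ Icc (0 : ℝ) 1, -1 ≤ lam2 x ∧ lam2 x < 0)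
    (hleft : ∀ x ∈ Icc (0 : ℝ) (1 / 2), lam2 x = -1)
    (htime : -(∫ ξ in (1 / 2 : ℝ)..1, 1 / lam2 ξ) = 3 / 2)
    (ha : MemLp a ∞ (volume.restrict (Ioo (0 : ℝ) 1)))
    (ha_right : ∀ᵐ x ∂(volume.restrict (Ioo (1 / 2 : ℝ) 1)), a x = 0)
    (ha_int : ∫ x in (0 : ℝ)..(1 / 2), a x = Real.pi / 2) :
    -- the standing conditions on the speeds hold, but two of them agree only on a part of `[0,1]`
    (HyperbolicControl.OrderedSpeeds (HyperbolicControl.exampleSpeeds lam2) ∧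
      ¬ HyperbolicControl.AgreeSomewhereImpliesEverywhere
          (HyperbolicControl.exampleSpeeds lam2)) ∧
    -- the travel times
    (HyperbolicControl.travelTime (HyperbolicControl.exampleSpeeds lam2) (Sum.inl 0) = 1 ∧
      HyperbolicControl.travelTime (HyperbolicControl.exampleSpeeds lam2) (Sum.inl 1) = 2 ∧
      HyperbolicControl.travelTime (HyperbolicControl.exampleSpeeds lam2) (Sum.inr 0) = 2 ∧
      HyperbolicControl.travelTime (HyperbolicControl.exampleSpeeds lam2) (Sum.inr 1) = 1 ∧
      HyperbolicControl.travelTime (HyperbolicControl.exampleSpeeds lam2) (Sum.inl 1) +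
        HyperbolicControl.travelTime (HyperbolicControl.exampleSpeeds lam2) (Sum.inr 0) = 4) ∧
    -- the coupled system
    (∀ T : ℝ, 0 < T →
      (HyperbolicControl.ExactlyControllable (HyperbolicControl.exampleSpeeds lam2)
        (HyperbolicControl.exampleCoupling a) 1 T ↔ 4 ≤ T)) ∧
    HyperbolicControl.minimalTime (HyperbolicControl.exampleSpeeds lam2)
      (HyperbolicControl.exampleCoupling a) 1 = 4 ∧
    -- the same system without internal coupling
    (∀ T : ℝ, 0 < T →
      (HyperbolicControl.ExactlyControllable (HyperbolicControl.exampleSpeeds lam2)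
        (HyperbolicControl.exampleCoupling (fun _ => 0)) 1 T ↔ 3 ≤ T)) ∧
    HyperbolicControl.minimalTime (HyperbolicControl.exampleSpeeds lam2)
      (HyperbolicControl.exampleCoupling (fun _ => 0)) 1 = 3 := by
  open HyperbolicControl in
  have hint := integral_inv_speed hlip hbound hleft htime
  obtain ⟨L, σ, heq, hcoef⟩ := exists_extension hlip hbound hleft htime
  obtain ⟨θ, t1, t2, t3, t4, t5⟩ := exists_angle ha ha_right ha_int
  have hlam : ∀ i, EqOn (exampleSpeeds lam2 i) (exampleSpeeds L i) (Icc 0 1) := by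
    intro i x hx
    rcases i with i | i <;> fin_cases i
    exacts [rfl, heq hx, rfl, rfl]
  have hcoupled : ∀ T : ℝ, 0 < T →
      (ExactlyControllable (exampleSpeeds lam2) (exampleCoupling a) 1 T ↔ 4 ≤ T) := fun T hT =>
    (exactlyControllable_congr hlam (t5.mono fun x hx => by simp only [exampleCoupling, hx])).trans
      ((hcoef θ t1 t2 t3).exactlyControllable_iff_of_angle_eq_pi_div_two t4 hT)
  -- The uncoupled system is the case of the zero angle.
  have hfree : ∀ T : ℝ, 0 < T →
      (ExactlyControllable (exampleSpeeds lam2) (exampleCoupling fun _ => 0) 1 T ↔ 3 ≤ T) :=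
    fun T hT =>
      (exactlyControllable_congr hlam (Filter.Eventually.of_forall fun x => by
        simp only [exampleCoupling, deriv_const])).trans
        ((hcoef (fun _ => 0) ⟨0, LipschitzWith.const _⟩ (fun _ _ => rfl)
          fun _ _ => rfl).exactlyControllable_iff_of_angle_eq_zero (fun _ => rfl) hT)
  have e1 : travelTime (exampleSpeeds lam2) (Sum.inl 0) = 1 := by
    simp [travelTime, exampleSpeeds]
  have e2 : travelTime (exampleSpeeds lam2) (Sum.inl 1) = 2 := by
    change -(∫ ξ in (0 : ℝ)..1, 1 / lam2 ξ) = 2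
    rw [hint, neg_neg]
  have e3 : travelTime (exampleSpeeds lam2) (Sum.inr 0) = 2 := by
    simp [travelTime, exampleSpeeds]
  have e4 : travelTime (exampleSpeeds lam2) (Sum.inr 1) = 1 := by
    simp [travelTime, exampleSpeeds]
  refine ⟨⟨orderedSpeeds_example hbound,
    not_agreeSomewhereImpliesEverywhere_example hleft htime⟩,
    ⟨e1, e2, e3, e4, by rw [e2, e3]; norm_num⟩, hcoupled, ?_, hfree, ?_⟩
  · rw [minimalTime_eq_of_iff (by norm_num) hcoupled]
    norm_num
  · rw [minimalTime_eq_of_iff (by norm_num) hfree]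
    norm_num
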